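/- **Proposition 4.2 (pdton303).** Let $d \ge 2$ and let $\Omega \subset \mathbb{R}^d$ be a bounded, connected, open (non-empty) set with boundary $\Gamma = \partial\Omega$. Let $\sigma$ be the $(d-1)$-dimensional Hausdorff measure on $\Gamma$ and assume that $\sigma(\Gamma) < \infty$. All functions are real valued; $H^1(\Omega)$ is the space of all $u \in L_2(\Omega)$ with weak gradient $\nabla u \in L_2(\Omega;\mathbb{R}^d)$, with norm $\|u\|_{H^1(\Omega)}^2 = \int_\Omega |u|^2 + \int_\Omega |\nabla u|^2$, and $H^1(\Omega)\cap C(\overline\Omega)$ is the space of all $u \in C(\overline\Omega)$ with $u|_\Omega \in H^1(\Omega)$. Let $\widetilde H^1(\Omega)$ be the closure of $H^1(\Omega) \cap C(\overline\Omega)$ in $H^1(\Omega)$. A function $\varphi \in L_2(\Gamma) = L_2(\Gamma,\sigma)$ is called a *trace* of $u \in H^1(\Omega)$ if there are $u_1,u_2,\ldots \in H^1(\Omega)\cap C(\overline\Omega)$ with $u_n \to u$ in $H^1(\Omega)$ and $u_n|_\Gamma \to \varphi$ in $L_2(\Gamma)$. The *trace on $\Omega$ is unique* if $0 \in L_2(\Gamma)$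 is the only trace of $0 \in H^1(\Omega)$. The *Robin form* $a_R$ has domain $D(a_R) = H^1(\Omega)\cap C(\overline\Omega)$ and is given by $$a_R(u,v) = \int_\Omega \nabla u \cdot \nabla v + \int_\Gamma u\, v \, d\sigma .$$ It is *closable* in $L_2(\Omega)$ if for every sequence $u_1,u_2,\ldots \in D(a_R)$ that is Cauchy for the norm $\|u\|_{a_R} = (a_R(u,u) + \|u\|_{L_2(\Omega)}^2)^{1/2}$ and satisfies $u_n \to 0$ in $L_2(\Omega)$, one has $a_R(u_n,u_n) \to 0$. The *relative capacity* of $A \subset \Gamma$ with respect to $\Omega$ is $$\operatorname{cap}_\Omega A = \inf\{ \|u\|_{H^1(\Omega)}^2 : u \in \widetilde H^1(\Omega) \text{ and there is an open } V \subset \mathbb{R}^d \text{ with } A \subset V \text{ and } u \ge 1 \text{ a.e. on } \Omega \cap V\}.$$ Then the following conditions are equivalent. 1. The trace on $\Omega$ is unique. 2. The form $a_R$ is closable in $L_2(\Omega)$. 3. For every Borel set $B \subset \Gamma$ with $\operatorname{cap}_\Omega B = 0$ one has $\sigma(B) = 0$. -/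

import Mathlib

open MeasureTheory Filter Topology Set
open scoped ContDiff

noncomputable section

namespace RoughTrace

/-- Euclidean space `ℝ^d`. -/
abbrev Euc (d : ℕ) : Type := EuclideanSpace ℝ (Fin d)

variable {d : ℕ}

/-- The real Hilbert space `L_2(Ω)`, with respect to Lebesgue measure. -/
abbrev L2 (Ω : Set (Euc d)) : Type := Lp ℝ 2 (volume.restrict Ω)

/-- The real Hilbert space `L_2(Ω; ℝ^d)` of square integrable vector fields. -/
abbrev L2Vec (Ω : Set (Euc d)) : Type := Lp (Euc d) 2 (volume.restrict Ω)

/-- The measure `σ` on the boundary `Γ = frontier Ω`: the `(d-1)`-dimensional Hausdorff measure,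
restricted to `Γ`. -/
def boundaryMeasure (Ω : Set (Euc d)) : Measure (Euc d) :=
  (Measure.hausdorffMeasure ((d : ℝ) - 1)).restrict (frontier Ω)

/-- The real Hilbert space `L_2(Γ) = L_2(Γ, σ)`. -/
abbrev L2Boundary (Ω : Set (Euc d)) : Type := Lp ℝ 2 (boundaryMeasure Ω)

/-- `g` is the weak (distributional) gradient of `u` on `Ω`:
`∫_Ω u ∂ᵢφ = - ∫_Ω gᵢ φ` for all test functions `φ ∈ C_c^∞(Ω)` and all `i`. -/
def IsWeakGradient (Ω : Set (Euc d)) (u : L2 Ω) (g : L2Vec Ω) : Prop :=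
  ∀ φ : Euc d → ℝ, ContDiff ℝ ∞ φ → HasCompactSupport φ → tsupport φ ⊆ Ω → ∀ i : Fin d,
    ∫ x in Ω, u x * fderiv ℝ φ x (EuclideanSpace.single i 1) = - ∫ x in Ω, g x i * φ x

theorem memLp_testFunction_deriv (Ω : Set (Euc d)) {φ : Euc d → ℝ} (hφ : ContDiff ℝ ∞ φ)
    (hc : HasCompactSupport φ) (v : Euc d) :
    MemLp (fun x => fderiv ℝ φ x v) 2 (volume.restrict Ω) := by
  have h1 : Continuous (fun x => fderiv ℝ φ x v) :=
    (hφ.continuous_fderiv (by simp)).clm_apply continuous_const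
  exact (h1.memLp_of_hasCompactSupport (hc.fderiv_apply (𝕜 := ℝ) v)).restrict Ω

theorem memLp_coord (Ω : Set (Euc d)) (g : L2Vec Ω) (i : Fin d) :
    MemLp (fun x => g x i) 2 (volume.restrict Ω) :=
  (EuclideanSpace.proj (𝕜 := ℝ) i).comp_memLp' (Lp.memLp g)

theorem IsWeakGradient.add {Ω : Set (Euc d)} {u u' : L2 Ω} {g g' : L2Vec Ω}
    (h : IsWeakGradient Ω u g) (h' : IsWeakGradient Ω u' g') :
    IsWeakGradient Ω (u + u') (g + g') := by
  intro φ hφ hc hs i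
  have hd := memLp_testFunction_deriv Ω hφ hc (EuclideanSpace.single i 1)
  have hφ2 : MemLp φ 2 (volume.restrict Ω) :=
    (hφ.continuous.memLp_of_hasCompactSupport hc).restrict Ω
  have e1 : ∫ x in Ω, (u + u' : L2 Ω) x * fderiv ℝ φ x (EuclideanSpace.single i 1)
      = ∫ x in Ω, (u x * fderiv ℝ φ x (EuclideanSpace.single i 1)
        + u' x * fderiv ℝ φ x (EuclideanSpace.single i 1)) := by
    apply integral_congr_ae
    filter_upwards [Lp.coeFn_add u u'] with x hx
    rw [hx, Pi.add_apply, add_mul]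
  have e2 : ∫ x in Ω, (g + g' : L2Vec Ω) x i * φ x
      = ∫ x in Ω, (g x i * φ x + g' x i * φ x) := by
    apply integral_congr_ae
    filter_upwards [Lp.coeFn_add g g'] with x hx
    rw [hx, Pi.add_apply, PiLp.add_apply, add_mul]
  have i1 := integral_add ((Lp.memLp u).integrable_mul hd) ((Lp.memLp u').integrable_mul hd)
  have i2 := integral_add ((memLp_coord Ω g i).integrable_mul hφ2)
    ((memLp_coord Ω g' i).integrable_mul hφ2)
  simp only [Pi.mul_apply] at i1 i2
  rw [e1, e2, i1, i2, h φ hφ hc hs i, h' φ hφ hc hs i]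
  ring

theorem IsWeakGradient.smul {Ω : Set (Euc d)} {u : L2 Ω} {g : L2Vec Ω} (c : ℝ)
    (h : IsWeakGradient Ω u g) : IsWeakGradient Ω (c • u) (c • g) := by
  intro φ hφ hc hs i
  have e1 : ∫ x in Ω, (c • u : L2 Ω) x * fderiv ℝ φ x (EuclideanSpace.single i 1)
      = ∫ x in Ω, c * (u x * fderiv ℝ φ x (EuclideanSpace.single i 1)) := by
    apply integral_congr_ae
    filter_upwards [Lp.coeFn_smul c u] with x hx
    rw [hx, Pi.smul_apply, smul_eq_mul, mul_assoc]
  have e2 : ∫ x in Ω, (c • g : L2Vec Ω) x i * φ x = ∫ x in Ω, c * (g x i * φ x) := by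
    apply integral_congr_ae
    filter_upwards [Lp.coeFn_smul c g] with x hx
    rw [hx, Pi.smul_apply, PiLp.smul_apply, smul_eq_mul, mul_assoc]
  rw [e1, e2, integral_const_mul, integral_const_mul, h φ hφ hc hs i]
  ring

theorem isWeakGradient_zero (Ω : Set (Euc d)) : IsWeakGradient Ω 0 0 := by
  intro φ _ _ _ i
  have e1 : ∫ x in Ω, (0 : L2 Ω) x * fderiv ℝ φ x (EuclideanSpace.single i 1) = 0 := by
    apply integral_eq_zero_of_ae
    filter_upwards [Lp.coeFn_zero ℝ 2 (volume.restrict Ω)] with x hx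
    have hx' : (0 : L2 Ω) x = 0 := hx
    rw [hx', zero_mul, Pi.zero_apply]
  have e2 : ∫ x in Ω, (0 : L2Vec Ω) x i * φ x = 0 := by
    apply integral_eq_zero_of_ae
    filter_upwards [Lp.coeFn_zero (Euc d) 2 (volume.restrict Ω)] with x hx
    have hx' : (0 : L2Vec Ω) x = 0 := hx
    rw [hx', PiLp.zero_apply, zero_mul, Pi.zero_apply]
  rw [e1, e2, neg_zero]

/-- The Sobolev space `H^1(Ω)`: the pairs `(u, ∇u)` where `u ∈ L_2(Ω)` has weak gradient
`∇u ∈ L_2(Ω; ℝ^d)`. The weak gradient is determined by `u`, so that a pair is the same thing as a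
function `u ∈ H^1(Ω)`. The norm is the usual one,
`‖u‖² = ∫_Ω |u|² + ∫_Ω |∇u|²`, inherited from the Hilbert space `L_2(Ω) × L_2(Ω; ℝ^d)`. -/
def H1 (Ω : Set (Euc d)) : Submodule ℝ (WithLp 2 (L2 Ω × L2Vec Ω)) where
  carrier := {p | IsWeakGradient Ω p.fst p.snd}
  add_mem' := fun h h' => IsWeakGradient.add h h'
  zero_mem' := isWeakGradient_zero Ω
  smul_mem' := fun c _ h => IsWeakGradient.smul c h

/-- The function underlying an element of `H^1(Ω)`, that is the embedding
`H^1(Ω) → L_2(Ω)`. -/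
def H1.toL2 (Ω : Set (Euc d)) : H1 Ω →ₗ[ℝ] L2 Ω :=
  (WithLp.fstₗ 2 ℝ (L2 Ω) (L2Vec Ω)).comp (H1 Ω).subtype

/-- The weak gradient, as a map `H^1(Ω) → L_2(Ω; ℝ^d)`. -/
def H1.grad (Ω : Set (Euc d)) : H1 Ω →ₗ[ℝ] L2Vec Ω :=
  (WithLp.sndₗ 2 ℝ (L2 Ω) (L2Vec Ω)).comp (H1 Ω).subtype

/-- A continuous function on `closure Ω`, extended by `0` to a function on `ℝ^d`. It is only
ever evaluated on `Ω` and on the boundary of `Ω`. -/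
def ext {Ω : Set (Euc d)} (f : C(closure Ω, ℝ)) : Euc d → ℝ :=
  Function.extend Subtype.val f 0

theorem ext_add {Ω : Set (Euc d)} (f g : C(closure Ω, ℝ)) : ext (f + g) = ext f + ext g := by
  have h := Function.extend_add (Subtype.val : closure Ω → Euc d) (f : closure Ω → ℝ) g 0 0
  rw [add_zero] at h
  exact h

theorem ext_smul {Ω : Set (Euc d)} (c : ℝ) (f : C(closure Ω, ℝ)) : ext (c • f) = c • ext f := by
  have h := Function.extend_smul c (Subtype.val : closure Ω → Euc d) (f : closure Ω → ℝ) 0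
  rw [smul_zero] at h
  exact h

theorem ext_zero {Ω : Set (Euc d)} : ext (0 : C(closure Ω, ℝ)) = 0 :=
  Function.extend_zero _

/-- The space `H^1(Ω) ∩ C(closure Ω)`: pairs of `u ∈ H^1(Ω)` and `f ∈ C(closure Ω)` that agree
almost everywhere on `Ω`. Each component determines the other one when `Ω` is open. -/
def H1Cont (Ω : Set (Euc d)) : Submodule ℝ (H1 Ω × C(closure Ω, ℝ)) where
  carrier := {p | ∀ᵐ x ∂(volume.restrict Ω), H1.toL2 Ω p.1 x = ext p.2 x}
  add_mem' := by
    intro p q hp hq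
    simp only [mem_ofPred_eq] at hp hq ⊢
    rw [Prod.fst_add, Prod.snd_add, map_add, ext_add]
    filter_upwards [hp, hq, Lp.coeFn_add (H1.toL2 Ω p.1) (H1.toL2 Ω q.1)] with x h1 h2 h3
    rw [h3, Pi.add_apply, Pi.add_apply, h1, h2]
  zero_mem' := by
    simp only [mem_ofPred_eq]
    rw [Prod.fst_zero, Prod.snd_zero, map_zero, ext_zero]
    exact Lp.coeFn_zero ℝ 2 (volume.restrict Ω)
  smul_mem' := by
    intro c p hp
    simp only [mem_ofPred_eq] at hp ⊢
    rw [Prod.smul_fst, Prod.smul_snd, map_smul, ext_smul]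
    filter_upwards [hp, Lp.coeFn_smul c (H1.toL2 Ω p.1)] with x h1 h2
    rw [h2, Pi.smul_apply, Pi.smul_apply, h1]

/-- The inclusion `H^1(Ω) ∩ C(closure Ω) → H^1(Ω)`. -/
def H1Cont.toH1 (Ω : Set (Euc d)) : H1Cont Ω →ₗ[ℝ] H1 Ω :=
  (LinearMap.fst ℝ (H1 Ω) C(closure Ω, ℝ)).comp (H1Cont Ω).subtype

/-- The pointwise values of `u ∈ H^1(Ω) ∩ C(closure Ω)` on `closure Ω` (and `0` elsewhere). Its
restriction to `frontier Ω` is `u|_Γ`. -/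
def H1Cont.values {Ω : Set (Euc d)} (u : H1Cont Ω) : Euc d → ℝ :=
  ext (u : H1 Ω × C(closure Ω, ℝ)).2

/-- `φ ∈ L_2(Γ)` is a trace of `u ∈ H^1(Ω)`: there are `u_n ∈ H^1(Ω) ∩ C(closure Ω)` with
`u_n → u` in `H^1(Ω)` and `u_n|_Γ → φ` in `L_2(Γ)`. -/
def IsTrace (Ω : Set (Euc d)) (u : H1 Ω) (φ : L2Boundary Ω) : Prop :=
  ∃ w : ℕ → H1Cont Ω,
    Tendsto (fun n => H1Cont.toH1 Ω (w n)) atTop (𝓝 u) ∧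
    Tendsto (fun n => eLpNorm (fun x => H1Cont.values (w n) x - φ x) 2 (boundaryMeasure Ω)) atTop (𝓝 0)

/-- The trace on `Ω` is unique: `0 ∈ L_2(Γ)` is the only trace of `0 ∈ H^1(Ω)`. -/
def TraceUnique (Ω : Set (Euc d)) : Prop :=
  ∀ φ : L2Boundary Ω, IsTrace Ω 0 φ ↔ φ = 0

/-- The Robin form `a_R(u, v) = ∫_Ω ∇u · ∇v + ∫_Γ u v dσ` with domain
`H^1(Ω) ∩ C(closure Ω)`. -/
def robinForm (Ω : Set (Euc d)) (u v : H1Cont Ω) : ℝ :=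
  (∫ x in Ω, inner ℝ (H1.grad Ω (H1Cont.toH1 Ω u) x) (H1.grad Ω (H1Cont.toH1 Ω v) x)) +
    ∫ x, H1Cont.values u x * H1Cont.values v x ∂(boundaryMeasure Ω)

/-- The inclusion of the form domain `H^1(Ω) ∩ C(closure Ω)` into `L_2(Ω)`. -/
def H1Cont.toL2 (Ω : Set (Euc d)) : H1Cont Ω →ₗ[ℝ] L2 Ω :=
  (H1.toL2 Ω).comp (H1Cont.toH1 Ω)

/-- A (positive, symmetric) form `a` with domain `D`, embedded by `ι` in a Hilbert space `H`, is
closable in `H` if every sequence in `D` which is Cauchy for the form norm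
`‖u‖_a² = a(u, u) + ‖u‖_H²` and tends to `0` in `H` satisfies `a(u_n, u_n) → 0`. -/
def IsClosableForm {D H : Type*} [AddCommGroup D] [Module ℝ D] [NormedAddCommGroup H]
    [InnerProductSpace ℝ H] (ι : D →ₗ[ℝ] H) (a : D → D → ℝ) : Prop :=
  ∀ w : ℕ → D,
    Tendsto (fun p : ℕ × ℕ => a (w p.1 - w p.2) (w p.1 - w p.2) + ‖ι (w p.1 - w p.2)‖ ^ 2)
      atTop (𝓝 0) →
    Tendsto (fun n => ι (w n)) atTop (𝓝 0) →
    Tendsto (fun n => a (w n) (w n)) atTop (𝓝 0)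

/-- The closure of `H^1(Ω) ∩ C(closure Ω)` in `H^1(Ω)`. -/
def H1Tilde (Ω : Set (Euc d)) : Set (H1 Ω) :=
  closure (range (H1Cont.toH1 Ω))

/-- The relative capacity of `A` with respect to `Ω`: the infimum of `‖u‖²_{H^1(Ω)}` over the `u`
in the closure of `H^1(Ω) ∩ C(closure Ω)` such that `u ≥ 1` a.e. on `Ω ∩ V` for some open
`V ⊆ ℝ^d` containing `A`. -/
def relCap (Ω A : Set (Euc d)) : ℝ :=
  sInf {r : ℝ | ∃ u ∈ H1Tilde Ω, ∃ V : Set (Euc d), IsOpen V ∧ A ⊆ V ∧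
    (∀ᵐ x ∂(volume.restrict (Ω ∩ V)), 1 ≤ H1.toL2 Ω u x) ∧ r = ‖u‖ ^ 2}

end RoughTrace

end

noncomputable section

namespace RoughTrace

open scoped Convolution ENNReal Manifold

/-! The square of the form norm is `‖u‖² + ‖u|_Γ‖²`, the `H^1(Ω)` norm plus the `L_2(Γ)` norm
(`robinForm_self_add_norm_sq`). So a form-Cauchy sequence converges in `H^1(Ω)` and on `Γ`. As
`H^1(Ω)` embeds injectively in `L_2(Ω)`, closability says exactly that boundary values vanish in the
limit when the `H^1` limit is `0`, which is uniqueness of the trace.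

Capacity implies uniqueness by Borel-Cantelli. If `φ` is a trace of `0`, a fast subsequence `v_n`
has `(n+1) v_n` of norm at most `2^{-n}`. The limsup of the sets where `(n+1)|v_n| > 1` has capacity
zero, because tails of a convergent series of nonnegative functions, each at least `1` on one such
set, are admissible. So `|v_n| ≤ 1/(n+1)` eventually, σ-a.e., and `φ = 0` (`traceUnique_of_relCap`).

Conversely, inner regularity reduces to a compact subset `K` of a set of capacity zero. Admissible
functions of small norm are only limits of continuous ones; `H1Cont.exists_eq_one` turns them into
continuous functions of small norm with values in `[0,1]` and equal to `1` on `K`. Cutting these off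
near `K` shows that the indicator of `K` is a trace of `0`, so `σ(K) = 0`.

All truncations are made with a smooth function, so that a chain rule for smooth outer functions
suffices (`HasWeakDeriv.comp_of_continuousOn`). -/

/-! ### Mollification on `ℝ^d`. -/

/-- Convolution with an even kernel is symmetric with respect to the `L_2` pairing. -/
theorem integral_convolution_mul_comm {d : ℕ} {ρ U ψ : Euc d → ℝ} {C : ℝ}
    (hρ : Integrable ρ) (heven : ∀ x, ρ (-x) = ρ x) (hU : Integrable U)
    (hψ : Continuous ψ) (hC : ∀ x, ‖ψ x‖ ≤ C) :
    ∫ x, (ρ ⋆[ContinuousLinearMap.lsmul ℝ ℝ, volume] U) x * ψ x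
      = ∫ y, U y * (ρ ⋆[ContinuousLinearMap.lsmul ℝ ℝ, volume] ψ) y := by
  have hint : Integrable (fun p : Euc d × Euc d => (U p.2 * ρ (p.1 - p.2)) * ψ p.1)
      (volume.prod volume) := by
    have h1 := hU.convolution_integrand (ContinuousLinearMap.lsmul ℝ ℝ) hρ
    simp only [ContinuousLinearMap.lsmul_apply, smul_eq_mul] at h1
    exact h1.mul_bdd (c := C) (hψ.comp continuous_fst).aestronglyMeasurable
      (Eventually.of_forall fun p => hC p.1)
  have e1 : ∀ x, (ρ ⋆[ContinuousLinearMap.lsmul ℝ ℝ, volume] U) x * ψ x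
      = ∫ y, (U y * ρ (x - y)) * ψ x := by
    intro x
    rw [convolution_lsmul_swap, ← integral_mul_const]
    simp only [smul_eq_mul, mul_comm]
  have e2 : ∀ y, U y * (ρ ⋆[ContinuousLinearMap.lsmul ℝ ℝ, volume] ψ) y
      = ∫ x, (U y * ρ (x - y)) * ψ x := by
    intro y
    rw [convolution_lsmul_swap, ← integral_const_mul]
    congr 1 with x
    rw [smul_eq_mul, ← heven, neg_sub, mul_assoc]
  simp only [e1, e2]
  exact integral_integral_swap hint

/-- A convolution with a probability density is bounded by any bound of the function. -/
theorem norm_normed_convolution_le {d : ℕ} (b : ContDiffBump (0 : Euc d)) {f : Euc d → ℝ} {C : ℝ}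
    (hC : ∀ x, ‖f x‖ ≤ C) (x : Euc d) :
    ‖(b.normed volume ⋆[ContinuousLinearMap.lsmul ℝ ℝ, volume] f) x‖ ≤ C := by
  rw [convolution_lsmul]
  calc ‖∫ t, b.normed volume t • f (x - t)‖ ≤ ∫ t, b.normed volume t * C := by
        apply norm_integral_le_of_norm_le (b.integrable_normed.mul_const C)
        refine Eventually.of_forall fun t => ?_
        rw [norm_smul, Real.norm_of_nonneg (b.nonneg_normed t)]
        exact mul_le_mul_of_nonneg_left (hC _) (b.nonneg_normed t)
    _ = C := by rw [integral_mul_const, b.integral_normed, one_mul]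

/-- The standard sequence of bumps with shrinking supports. -/
def shrinkingBump (d n : ℕ) : ContDiffBump (0 : Euc d) where
  rIn := 1 / (2 * ((n : ℝ) + 1))
  rOut := 1 / ((n : ℝ) + 1)
  rIn_pos := by positivity
  rIn_lt_rOut := by
    apply one_div_lt_one_div_of_lt <;> linarith [n.cast_nonneg (α := ℝ)]

theorem tendsto_shrinkingBump_rOut (d : ℕ) :
    Tendsto (fun n => (shrinkingBump d n).rOut) atTop (𝓝 0) :=
  tendsto_one_div_add_atTop_nhds_zero_nat

/-- The mollified function. -/
def mollify {d : ℕ} (n : ℕ) (f : Euc d → ℝ) : Euc d → ℝ :=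
  (shrinkingBump d n).normed volume ⋆[ContinuousLinearMap.lsmul ℝ ℝ, volume] f

theorem contDiff_mollify {d : ℕ} (n : ℕ) {f : Euc d → ℝ} (hf : LocallyIntegrable f) :
    ContDiff ℝ ∞ (mollify n f) :=
  (shrinkingBump d n).hasCompactSupport_normed.contDiff_convolution_left _
    (shrinkingBump d n).contDiff_normed hf

theorem norm_mollify_le {d : ℕ} (n : ℕ) {f : Euc d → ℝ} {C : ℝ} (hC : ∀ x, ‖f x‖ ≤ C)
    (x : Euc d) : ‖mollify n f x‖ ≤ C :=
  norm_normed_convolution_le _ hC x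

theorem tsupport_mollify_subset {d : ℕ} (n : ℕ) (f : Euc d → ℝ) :
    tsupport (mollify n f) ⊆ Metric.cthickening (1 / ((n : ℝ) + 1)) (tsupport f) := by
  apply closure_minimal _ Metric.isClosed_cthickening
  refine (support_convolution_subset _).trans ?_
  rintro _ ⟨a, ha, b, hb, rfl⟩
  rw [(shrinkingBump d n).support_normed_eq, mem_ball_zero_iff] at ha
  refine Metric.mem_cthickening_of_dist_le _ b _ _ (subset_tsupport _ hb) ?_
  rw [dist_eq_norm, add_sub_cancel_right]
  exact ha.le

theorem hasCompactSupport_mollify {d : ℕ} (n : ℕ) {f : Euc d → ℝ} (hf : HasCompactSupport f) :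
    HasCompactSupport (mollify n f) :=
  HasCompactSupport.convolution _ (shrinkingBump d n).hasCompactSupport_normed hf

theorem fderiv_mollify {d : ℕ} (n : ℕ) {f : Euc d → ℝ} (hf : ContDiff ℝ ∞ f)
    (hc : HasCompactSupport f) (e x : Euc d) :
    fderiv ℝ (mollify n f) x e = mollify n (fun y => fderiv ℝ f y e) x := by
  have hl : LocallyIntegrable ((shrinkingBump d n).normed volume) volume :=
    (shrinkingBump d n).integrable_normed.locallyIntegrable
  have h := hc.hasFDerivAt_convolution_right (ContinuousLinearMap.lsmul ℝ ℝ) hl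
    (hf.of_le (by simp)) x
  rw [mollify, h.fderiv,
    convolution_precompR_apply _ hl (hc.fderiv (𝕜 := ℝ)) (hf.continuous_fderiv (by simp))]
  rfl

theorem integral_mollify_mul_comm {d : ℕ} (n : ℕ) {U ψ : Euc d → ℝ} {C : ℝ}
    (hU : Integrable U) (hψ : Continuous ψ) (hC : ∀ x, ‖ψ x‖ ≤ C) :
    ∫ x, mollify n U x * ψ x = ∫ y, U y * mollify n ψ y :=
  integral_convolution_mul_comm (shrinkingBump d n).integrable_normed
    (fun x => (shrinkingBump d n).normed_neg x) hU hψ hC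

theorem tendsto_mollify {d : ℕ} {g : ℕ → Euc d → ℝ} {k : ℕ → Euc d} {x : Euc d} {z : ℝ}
    (hm : ∀ n, AEStronglyMeasurable (g n) volume)
    (hg : Tendsto (Function.uncurry g) (atTop ×ˢ 𝓝 x) (𝓝 z))
    (hk : Tendsto k atTop (𝓝 x)) :
    Tendsto (fun n => mollify n (g n) (k n)) atTop (𝓝 z) :=
  ContDiffBump.convolution_tendsto_right (tendsto_shrinkingBump_rOut d) (Eventually.of_forall hm)
    hg hk

/-- Joint convergence of mollifications at a point of continuity. -/
theorem tendsto_uncurry_mollify {d : ℕ} {U : Euc d → ℝ} {x : Euc d}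
    (hm : AEStronglyMeasurable U volume) (hU : ContinuousAt U x) :
    Tendsto (Function.uncurry fun n y => mollify n U y) (atTop ×ˢ 𝓝 x) (𝓝 (U x)) := by
  have := ContDiffBump.convolution_tendsto_right (μ := volume) (l := (atTop : Filter ℕ) ×ˢ 𝓝 x)
    (φ := fun p : ℕ × Euc d => shrinkingBump d p.1) (g := fun _ => U)
    (k := fun p => p.2) (x₀ := x) (z₀ := U x)
    ((tendsto_shrinkingBump_rOut d).comp tendsto_fst) (Eventually.of_forall fun _ => hm)
    (hU.tendsto.comp tendsto_snd) tendsto_snd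
  exact this

/-- Integration by parts against a function of compact support. -/
theorem integral_mul_fderiv_of_hasCompactSupport {d : ℕ} {f g : Euc d → ℝ}
    (hf : ContDiff ℝ ∞ f) (hg : ContDiff ℝ ∞ g) (hc : HasCompactSupport g) (e : Euc d) :
    ∫ x, f x * fderiv ℝ g x e = - ∫ x, fderiv ℝ f x e * g x := by
  have cf : Continuous fun x => fderiv ℝ f x e :=
    (hf.continuous_fderiv (by simp)).clm_apply continuous_const
  have cg : Continuous fun x => fderiv ℝ g x e :=
    (hg.continuous_fderiv (by simp)).clm_apply continuous_const
  refine integral_mul_fderiv_eq_neg_fderiv_mul_of_integrable ?_ ?_ ?_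
    (fun x _ => hf.differentiable (by simp) x) (fun x _ => hg.differentiable (by simp) x)
  · exact (cf.mul hg.continuous).integrable_of_hasCompactSupport hc.mul_left
  · exact (hf.continuous.mul cg).integrable_of_hasCompactSupport
      (hc.fderiv_apply (𝕜 := ℝ) e).mul_left
  · exact (hf.continuous.mul hg.continuous).integrable_of_hasCompactSupport hc.mul_left

/-! ### Weak derivatives and the chain rule. -/

/-- `g` is the weak derivative of `f` on `Ω` in the direction `e`. -/
def HasWeakDeriv {d : ℕ} (Ω : Set (Euc d)) (e : Euc d) (f g : Euc d → ℝ) : Prop :=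
  ∀ φ : Euc d → ℝ, ContDiff ℝ ∞ φ → HasCompactSupport φ → tsupport φ ⊆ Ω →
    ∫ x in Ω, f x * fderiv ℝ φ x e = - ∫ x in Ω, g x * φ x

/-- Chain rule for weak derivatives of bounded continuous functions. -/
theorem HasWeakDeriv.comp_of_continuousOn {d : ℕ} {Ω : Set (Euc d)} (hΩ : IsOpen Ω)
    (hb : Bornology.IsBounded Ω) {e : Euc d} {f g : Euc d → ℝ} {M : ℝ}
    (hf : ContinuousOn f Ω) (hM : ∀ x ∈ Ω, ‖f x‖ ≤ M) (hg : IntegrableOn g Ω)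
    (h : HasWeakDeriv Ω e f g) {F : ℝ → ℝ} (hF : ContDiff ℝ ∞ F) :
    HasWeakDeriv Ω e (fun x => F (f x)) (fun x => deriv F (f x) * g x) := by
  intro φ hφ hc hs
  have hΩm := hΩ.measurableSet
  rcases Ω.eq_empty_or_nonempty with rfl | ⟨x₀, hx₀⟩
  · simp
  have hM0 : 0 ≤ M := (norm_nonneg _).trans (hM x₀ hx₀)
  -- Extension by zero makes convolution on `ℝ^d` available, keeping the bound everywhere and
  -- continuity at points of `Ω`.
  set U : Euc d → ℝ := Ω.indicator f with hUdef
  have hUf : ∀ x ∈ Ω, U x = f x := fun x hx => indicator_of_mem hx f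
  have hUM : ∀ x, ‖U x‖ ≤ M := by
    intro x
    by_cases hx : x ∈ Ω
    · rw [hUf x hx]; exact hM x hx
    · rw [hUdef, indicator_of_notMem hx, norm_zero]; exact hM0
  have hUi : Integrable U := by
    rw [hUdef, integrable_indicator_iff hΩm]
    exact IntegrableOn.of_bound hb.measure_lt_top (hf.aestronglyMeasurable hΩm) M
      ((ae_restrict_iff' hΩm).2 (Eventually.of_forall hM))
  have hUc : ∀ x ∈ Ω, ContinuousAt U x := by
    intro x hx
    refine (hf.continuousAt (hΩ.mem_nhds hx)).congr ?_
    filter_upwards [hΩ.mem_nhds hx] with y hy using (hUf y hy).symm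
  have hF' : ContDiff ℝ ∞ (deriv F) := by
    have := (contDiff_infty_iff_deriv.1 hF).2
    exact this
  obtain ⟨A, hA⟩ : ∃ A, ∀ t ∈ Icc (-M) M, ‖F t‖ ≤ A :=
    isCompact_Icc.exists_bound_of_continuousOn hF.continuous.continuousOn
  obtain ⟨A', hA'⟩ : ∃ A, ∀ t ∈ Icc (-M) M, ‖deriv F t‖ ≤ A :=
    isCompact_Icc.exists_bound_of_continuousOn hF'.continuous.continuousOn
  have hA'0 : 0 ≤ A' := (norm_nonneg _).trans (hA' 0 ⟨by linarith, hM0⟩)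
  obtain ⟨B, hB⟩ : ∃ B, ∀ x, ‖φ x‖ ≤ B := hc.exists_bound_of_continuous hφ.continuous
  set u : ℕ → Euc d → ℝ := fun n => mollify n U with hu
  have hus : ∀ n, ContDiff ℝ ∞ (u n) := fun n => contDiff_mollify n hUi.locallyIntegrable
  have huM : ∀ n x, u n x ∈ Icc (-M) M := fun n x => abs_le.1 (norm_mollify_le n hUM x)
  set ψ : ℕ → Euc d → ℝ := fun n x => deriv F (u n x) * φ x with hψ
  have hψs : ∀ n, ContDiff ℝ ∞ (ψ n) := fun n => (hF'.comp (hus n)).mul hφ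
  have hψc : ∀ n, HasCompactSupport (ψ n) := fun n => hc.mul_left
  have hψB : ∀ n x, ‖ψ n x‖ ≤ A' * B := fun n x => by
    rw [hψ, norm_mul]
    exact mul_le_mul (hA' _ (huM n x)) (hB x) (norm_nonneg _) hA'0
  have hψt : ∀ n, tsupport (ψ n) ⊆ tsupport φ := fun n =>
    closure_mono (Function.support_mul_subset_right _ _)
  have cφ : Continuous fun x => fderiv ℝ φ x e :=
    (hφ.continuous_fderiv (by simp)).clm_apply continuous_const
  have hcφ := hc.fderiv_apply (𝕜 := ℝ) e
  -- The chain rule is classical for the mollification `u n`. Writing `F'(u n) φ = ψ n` and moving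
  -- the mollifier from `U` to `ψ n` by symmetry lets the weak derivative of `f` be tested against
  -- `mollify n (ψ n)`. Thus no convergence of derivatives of `u n` is ever needed.
  have key : ∀ᶠ n in atTop, ∫ x in Ω, F (u n x) * fderiv ℝ φ x e
      = - ∫ x in Ω, g x * mollify n (ψ n) x := by
    obtain ⟨δ, hδ, hδΩ⟩ := hc.isCompact.exists_cthickening_subset_open hΩ hs
    have hev : ∀ᶠ n : ℕ in atTop, 1 / ((n : ℝ) + 1) < δ :=
      tendsto_one_div_add_atTop_nhds_zero_nat.eventually (gt_mem_nhds hδ)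
    filter_upwards [hev] with n hn
    have s1 : ∫ x in Ω, F (u n x) * fderiv ℝ φ x e = ∫ x, F (u n x) * fderiv ℝ φ x e := by
      apply setIntegral_eq_integral_of_forall_compl_eq_zero
      intro x hx
      have hx' : x ∉ tsupport φ := fun h => hx (hs h)
      have : fderiv ℝ φ x = 0 := by
        by_contra hne
        exact hx' (support_fderiv_subset ℝ hne)
      rw [this]; simp
    have s2 := integral_mul_fderiv_of_hasCompactSupport (hF.comp (hus n)) hφ hc e
    have s3 : ∀ x, fderiv ℝ (F ∘ u n) x e * φ x = fderiv ℝ (u n) x e * ψ n x := by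
      intro x
      have h1 := (hF.differentiable (by simp) (u n x)).hasDerivAt.comp_hasFDerivAt x
        ((hus n).differentiable (by simp) x).hasFDerivAt
      rw [h1.fderiv]
      simp only [smul_apply, smul_eq_mul, hψ]
      ring
    have s4 := integral_mul_fderiv_of_hasCompactSupport (hus n) (hψs n) (hψc n) e
    have cψ : Continuous fun x => fderiv ℝ (ψ n) x e :=
      ((hψs n).continuous_fderiv (by simp)).clm_apply continuous_const
    obtain ⟨B', hB'⟩ : ∃ B, ∀ x, ‖fderiv ℝ (ψ n) x e‖ ≤ B :=
      ((hψc n).fderiv_apply (𝕜 := ℝ) e).exists_bound_of_continuous cψ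
    have s5 := integral_mollify_mul_comm n hUi cψ hB'
    have s6 : ∫ y, U y * mollify n (fun y => fderiv ℝ (ψ n) y e) y
        = ∫ y in Ω, f y * fderiv ℝ (mollify n (ψ n)) y e := by
      rw [← integral_indicator hΩm]
      congr 1 with y
      by_cases hy : y ∈ Ω
      · rw [indicator_of_mem hy, hUf y hy, fderiv_mollify n (hψs n) (hψc n)]
      · rw [indicator_of_notMem hy, hUdef, indicator_of_notMem hy, zero_mul]
    -- This is a legitimate test function on `Ω`: mollification enlarges the support by at most
    -- `1/(n+1) < δ`.
    have s7 := h (mollify n (ψ n))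
      (contDiff_mollify n (hψs n).continuous.locallyIntegrable)
      (hasCompactSupport_mollify n (hψc n))
      ((tsupport_mollify_subset n (ψ n)).trans
        ((Metric.cthickening_mono hn.le _).trans
          ((Metric.cthickening_subset_of_subset _ (hψt n)).trans hδΩ)))
    rw [s1, ← s7, ← s6, ← s5]
    simp only [Function.comp_apply] at s2 s3
    rw [s2, s4]
    congr 1
    exact integral_congr_ae (Eventually.of_forall s3)
  have lim1 : Tendsto (fun n => ∫ x in Ω, F (u n x) * fderiv ℝ φ x e) atTop
      (𝓝 (∫ x in Ω, F (f x) * fderiv ℝ φ x e)) := by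
    apply tendsto_integral_of_dominated_convergence (fun x => A * ‖fderiv ℝ φ x e‖)
    · exact fun n => ((hF.continuous.comp (hus n).continuous).mul cφ).aestronglyMeasurable
    · exact ((cφ.integrable_of_hasCompactSupport hcφ).norm.const_mul A).integrableOn
    · intro n
      refine Eventually.of_forall fun x => ?_
      rw [norm_mul]
      exact mul_le_mul_of_nonneg_right (hA _ (huM n x)) (norm_nonneg _)
    · refine (ae_restrict_iff' hΩm).2 (Eventually.of_forall fun x hx => ?_)
      rw [← hUf x hx]
      refine Tendsto.mul_const _ ((hF.continuous.tendsto _).comp ?_)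
      exact tendsto_mollify (fun _ => hUi.aestronglyMeasurable)
        ((hUc x hx).tendsto.comp tendsto_snd) tendsto_const_nhds
  have lim2 : Tendsto (fun n => ∫ x in Ω, g x * mollify n (ψ n) x) atTop
      (𝓝 (∫ x in Ω, deriv F (f x) * g x * φ x)) := by
    apply tendsto_integral_of_dominated_convergence (fun x => ‖g x‖ * (A' * B))
    · exact fun n => hg.aestronglyMeasurable.mul
        (contDiff_mollify n (hψs n).continuous.locallyIntegrable).continuous.aestronglyMeasurable
    · exact hg.norm.mul_const _
    · intro n
      refine Eventually.of_forall fun x => ?_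
      rw [norm_mul]
      exact mul_le_mul_of_nonneg_left (norm_mollify_le n (hψB n) x) (norm_nonneg _)
    · refine (ae_restrict_iff' hΩm).2 (Eventually.of_forall fun x hx => ?_)
      have : deriv F (f x) * g x * φ x = g x * (deriv F (U x) * φ x) := by
        rw [hUf x hx]; ring
      rw [this]
      -- The mollified function `ψ n` itself varies with `n`, so its convergence is required jointly
      -- in `n` and in the point.
      refine Tendsto.const_mul _ (tendsto_mollify
        (fun n => (hψs n).continuous.aestronglyMeasurable) ?_ tendsto_const_nhds)
      exact ((hF'.continuous.tendsto _).comp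
        (tendsto_uncurry_mollify hUi.aestronglyMeasurable (hUc x hx))).mul
        ((hφ.continuous.tendsto x).comp tendsto_snd)
  exact tendsto_nhds_unique (lim1.congr' key) lim2.neg

/-! ### Continuous representatives and the Hilbert space `H^1(Ω)`. -/

theorem ext_apply {d : ℕ} {Ω : Set (Euc d)} (f : C(closure Ω, ℝ)) {x : Euc d}
    (hx : x ∈ closure Ω) : ext f x = f ⟨x, hx⟩ :=
  Subtype.val_injective.extend_apply f 0 ⟨x, hx⟩

theorem continuousOn_ext {d : ℕ} {Ω : Set (Euc d)} (f : C(closure Ω, ℝ)) :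
    ContinuousOn (ext f) (closure Ω) := by
  rw [continuousOn_iff_continuous_domRestrict]
  convert! f.continuous using 1
  ext x
  exact ext_apply f x.2

theorem H1Cont.continuousOn_values {d : ℕ} {Ω : Set (Euc d)} (w : H1Cont Ω) :
    ContinuousOn (H1Cont.values w) (closure Ω) :=
  continuousOn_ext _

theorem H1Cont.toL2_ae_eq_values {d : ℕ} {Ω : Set (Euc d)} (w : H1Cont Ω) :
    H1Cont.toL2 Ω w =ᵐ[volume.restrict Ω] H1Cont.values w :=
  w.2

theorem H1Cont.values_add {d : ℕ} {Ω : Set (Euc d)} (v w : H1Cont Ω) :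
    H1Cont.values (v + w) = H1Cont.values v + H1Cont.values w :=
  ext_add _ _

theorem H1Cont.values_smul {d : ℕ} {Ω : Set (Euc d)} (c : ℝ) (w : H1Cont Ω) :
    H1Cont.values (c • w) = c • H1Cont.values w :=
  ext_smul _ _

/-- For fixed test function and direction, both sides of the weak gradient identity are inner
products with fixed `L_2` elements, hence continuous. This yields completeness of `H^1(Ω)`. -/
theorem isClosed_H1 {d : ℕ} (Ω : Set (Euc d)) :
    IsClosed (H1 Ω : Set (WithLp 2 (L2 Ω × L2Vec Ω))) := by
  have : (H1 Ω : Set (WithLp 2 (L2 Ω × L2Vec Ω))) = ⋂ (φ : Euc d → ℝ) (_ : ContDiff ℝ ∞ φ)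
      (_ : HasCompactSupport φ) (_ : tsupport φ ⊆ Ω) (i : Fin d),
      {p : WithLp 2 (L2 Ω × L2Vec Ω) |
        ∫ x in Ω, p.fst x * fderiv ℝ φ x (EuclideanSpace.single i 1)
          = - ∫ x in Ω, p.snd x i * φ x} := by
    ext p
    simp only [mem_iInter]
    rfl
  rw [this]
  refine isClosed_iInter fun φ => isClosed_iInter fun hφ => isClosed_iInter fun hc =>
    isClosed_iInter fun hs => isClosed_iInter fun i => ?_
  have hd := memLp_testFunction_deriv Ω hφ hc (EuclideanSpace.single i 1)
  have hφ2 : MemLp (fun x => φ x • (EuclideanSpace.single i 1 : Euc d)) 2 (volume.restrict Ω) := by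
    have : MemLp φ 2 (volume.restrict Ω) :=
      (hφ.continuous.memLp_of_hasCompactSupport hc).restrict Ω
    exact (ContinuousLinearMap.toSpanSingleton ℝ (EuclideanSpace.single i 1 : Euc d)).comp_memLp' this
  have e1 : ∀ p : WithLp 2 (L2 Ω × L2Vec Ω),
      ∫ x in Ω, p.fst x * fderiv ℝ φ x (EuclideanSpace.single i 1)
        = inner ℝ (hd.toLp _) p.fst := by
    intro p
    rw [L2.inner_def]
    apply integral_congr_ae
    filter_upwards [hd.coeFn_toLp] with x hx
    rw [hx]
    rfl
  have e2 : ∀ p : WithLp 2 (L2 Ω × L2Vec Ω),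
      ∫ x in Ω, p.snd x i * φ x = inner ℝ (hφ2.toLp _) p.snd := by
    intro p
    rw [L2.inner_def]
    apply integral_congr_ae
    filter_upwards [hφ2.coeFn_toLp] with x hx
    rw [hx, inner_smul_left, EuclideanSpace.inner_single_left]
    simp [mul_comm]
  simp only [e1, e2]
  exact isClosed_eq (continuous_const.inner (WithLp.fstL 2 ℝ (L2 Ω) (L2Vec Ω)).continuous)
    (continuous_const.inner (WithLp.sndL 2 ℝ (L2 Ω) (L2Vec Ω)).continuous).neg

instance {d : ℕ} (Ω : Set (Euc d)) : CompleteSpace (H1 Ω) :=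
  (isClosed_H1 Ω).completeSpace_coe

theorem H1.norm_sq {d : ℕ} {Ω : Set (Euc d)} (u : H1 Ω) :
    ‖u‖ ^ 2 = ‖H1.toL2 Ω u‖ ^ 2 + ‖H1.grad Ω u‖ ^ 2 :=
  WithLp.prod_norm_sq_eq_of_L2 (u : WithLp 2 (L2 Ω × L2Vec Ω))

theorem H1.continuous_toL2 {d : ℕ} (Ω : Set (Euc d)) : Continuous (H1.toL2 Ω) :=
  (WithLp.fstL 2 ℝ (L2 Ω) (L2Vec Ω)).continuous.comp continuous_subtype_val

theorem H1.continuous_grad {d : ℕ} (Ω : Set (Euc d)) : Continuous (H1.grad Ω) :=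
  (WithLp.sndL 2 ℝ (L2 Ω) (L2Vec Ω)).continuous.comp continuous_subtype_val

/-- The weak gradient is unique. -/
theorem H1.toL2_injective {d : ℕ} {Ω : Set (Euc d)} (hΩ : IsOpen Ω) {u : H1 Ω}
    (hu : H1.toL2 Ω u = 0) : u = 0 := by
  have hw : IsWeakGradient Ω (H1.toL2 Ω u) (H1.grad Ω u) := u.2
  rw [hu] at hw
  have h0 : ∀ i : Fin d, ∀ᵐ x ∂(volume : Measure (Euc d)), x ∈ Ω → H1.grad Ω u x i = 0 := by
    intro i
    -- Fundamental lemma of the calculus of variations, applied to each coordinate of the gradient.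
    apply hΩ.ae_eq_zero_of_integral_contDiff_smul_eq_zero
    · have hloc : LocallyIntegrable (fun x => H1.grad Ω u x i) (volume.restrict Ω) :=
        (memLp_coord Ω (H1.grad Ω u) i).locallyIntegrable (by norm_num)
      rw [locallyIntegrableOn_iff hΩ.isLocallyClosed]
      intro k hk hkc
      have := hloc.integrableOn_isCompact hkc
      rwa [IntegrableOn, Measure.restrict_restrict_of_subset hk] at this
    · intro φ hφ hc hs
      have h := hw φ hφ hc hs i
      have e1 : ∫ x in Ω, (0 : L2 Ω) x * fderiv ℝ φ x (EuclideanSpace.single i 1) = 0 := by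
        apply integral_eq_zero_of_ae
        filter_upwards [Lp.coeFn_zero ℝ 2 (volume.restrict Ω)] with x hx
        have hx' : (0 : L2 Ω) x = 0 := hx
        rw [hx', zero_mul, Pi.zero_apply]
      rw [e1, eq_comm, neg_eq_zero] at h
      rw [← h, eq_comm]
      have : ∀ x, H1.grad Ω u x i * φ x = φ x • H1.grad Ω u x i := fun x => mul_comm _ _
      simp only [this]
      apply setIntegral_eq_integral_of_forall_compl_eq_zero
      intro x hx
      rw [image_eq_zero_of_notMem_tsupport fun h => hx (hs h), zero_smul]
  have hg : H1.grad Ω u = 0 := by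
    rw [Lp.eq_zero_iff_ae_eq_zero]
    rw [EventuallyEq, ae_restrict_iff' hΩ.measurableSet]
    filter_upwards [ae_all_iff.2 h0] with x hx hxΩ
    ext i
    exact hx i hxΩ
  have := H1.norm_sq u
  rw [hu, hg, norm_zero, norm_zero] at this
  simpa using this

/-! ### Boundary values, the Robin form, and closability. -/

theorem isFiniteMeasure_boundaryMeasure {d : ℕ} {Ω : Set (Euc d)}
    (hfin : Measure.hausdorffMeasure ((d : ℝ) - 1) (frontier Ω) < ⊤) :
    IsFiniteMeasure (boundaryMeasure Ω) :=
  ⟨by rw [boundaryMeasure, Measure.restrict_apply_univ]; exact hfin⟩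

theorem H1Cont.aestronglyMeasurable_values {d : ℕ} {Ω : Set (Euc d)} (w : H1Cont Ω) :
    AEStronglyMeasurable (H1Cont.values w) (boundaryMeasure Ω) :=
  ((H1Cont.continuousOn_values w).mono frontier_subset_closure).aestronglyMeasurable
    isClosed_frontier.measurableSet

theorem H1Cont.exists_bound {d : ℕ} {Ω : Set (Euc d)} (hb : Bornology.IsBounded Ω)
    (w : H1Cont Ω) : ∃ C, ∀ x ∈ closure Ω, ‖H1Cont.values w x‖ ≤ C :=
  hb.isCompact_closure.exists_bound_of_continuousOn (H1Cont.continuousOn_values w)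

theorem ae_mem_frontier {d : ℕ} (Ω : Set (Euc d)) : ∀ᵐ x ∂(boundaryMeasure Ω), x ∈ frontier Ω :=
  ae_restrict_mem isClosed_frontier.measurableSet

theorem H1Cont.memLp_values {d : ℕ} {Ω : Set (Euc d)} (hb : Bornology.IsBounded Ω)
    [IsFiniteMeasure (boundaryMeasure Ω)] (w : H1Cont Ω) :
    MemLp (H1Cont.values w) 2 (boundaryMeasure Ω) := by
  obtain ⟨C, hC⟩ := H1Cont.exists_bound hb w
  refine MemLp.of_bound (H1Cont.aestronglyMeasurable_values w) C ?_
  filter_upwards [ae_mem_frontier Ω] with x hx using hC x (frontier_subset_closure hx)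

/-- The restriction map `u ↦ u|_Γ` from `H^1(Ω) ∩ C(closure Ω)` to `L_2(Γ)`. -/
def traceMap {d : ℕ} {Ω : Set (Euc d)} (hb : Bornology.IsBounded Ω)
    [IsFiniteMeasure (boundaryMeasure Ω)] : H1Cont Ω →ₗ[ℝ] L2Boundary Ω where
  toFun w := (H1Cont.memLp_values hb w).toLp _
  map_add' v w := by
    rw [← MemLp.toLp_add]
    exact MemLp.toLp_congr _ _ (by rw [H1Cont.values_add])
  map_smul' c w := by
    rw [RingHom.id_apply, ← MemLp.toLp_const_smul]
    exact MemLp.toLp_congr _ _ (by rw [H1Cont.values_smul])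

theorem traceMap_ae_eq {d : ℕ} {Ω : Set (Euc d)} (hb : Bornology.IsBounded Ω)
    [IsFiniteMeasure (boundaryMeasure Ω)] (w : H1Cont Ω) :
    traceMap hb w =ᵐ[boundaryMeasure Ω] H1Cont.values w :=
  MemLp.coeFn_toLp (H1Cont.memLp_values hb w)

theorem isTrace_iff {d : ℕ} {Ω : Set (Euc d)} (hb : Bornology.IsBounded Ω)
    [IsFiniteMeasure (boundaryMeasure Ω)] {u : H1 Ω} {φ : L2Boundary Ω} :
    IsTrace Ω u φ ↔ ∃ w : ℕ → H1Cont Ω, Tendsto (fun n => H1Cont.toH1 Ω (w n)) atTop (𝓝 u) ∧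
      Tendsto (fun n => traceMap hb (w n)) atTop (𝓝 φ) := by
  refine exists_congr fun w => and_congr_right fun _ => ?_
  rw [Lp.tendsto_Lp_iff_tendsto_eLpNorm']
  refine tendsto_congr fun n => eLpNorm_congr_ae ?_
  filter_upwards [traceMap_ae_eq hb (w n)] with x hx
  rw [Pi.sub_apply, hx]

theorem robinForm_self {d : ℕ} {Ω : Set (Euc d)} (hb : Bornology.IsBounded Ω)
    [IsFiniteMeasure (boundaryMeasure Ω)] (w : H1Cont Ω) :
    robinForm Ω w w = ‖H1.grad Ω (H1Cont.toH1 Ω w)‖ ^ 2 + ‖traceMap hb w‖ ^ 2 := by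
  rw [← real_inner_self_eq_norm_sq, ← real_inner_self_eq_norm_sq, L2.inner_def, L2.inner_def,
    robinForm]
  congr 1
  apply integral_congr_ae
  filter_upwards [traceMap_ae_eq hb w] with x hx
  rw [hx]
  rfl

/-- This splitting makes form-Cauchy equivalent to Cauchy in `H^1(Ω)` together with Cauchy boundary
values in `L_2(Γ)`. -/
theorem robinForm_self_add_norm_sq {d : ℕ} {Ω : Set (Euc d)} (hb : Bornology.IsBounded Ω)
    [IsFiniteMeasure (boundaryMeasure Ω)] (w : H1Cont Ω) :
    robinForm Ω w w + ‖H1Cont.toL2 Ω w‖ ^ 2 = ‖H1Cont.toH1 Ω w‖ ^ 2 + ‖traceMap hb w‖ ^ 2 := by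
  rw [robinForm_self hb, H1.norm_sq]
  have : H1Cont.toL2 Ω w = H1.toL2 Ω (H1Cont.toH1 Ω w) := rfl
  rw [this]
  ring

theorem isTrace_zero_zero {d : ℕ} {Ω : Set (Euc d)} (hb : Bornology.IsBounded Ω)
    [IsFiniteMeasure (boundaryMeasure Ω)] : IsTrace Ω 0 0 := by
  rw [isTrace_iff hb]
  exact ⟨fun _ => 0, by simp, by simp⟩

theorem tendsto_norm_sq_zero_iff {α E : Type*} [SeminormedAddCommGroup E] {l : Filter α}
    {f : α → E} : Tendsto (fun a => ‖f a‖ ^ 2) l (𝓝 0) ↔ Tendsto f l (𝓝 0) := by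
  rw [tendsto_zero_iff_norm_tendsto_zero (f := f)]
  refine ⟨fun h => ?_, fun h => by simpa using h.pow 2⟩
  have := h.sqrt
  simpa using this

theorem cauchySeq_of_tendsto_norm_sq {E : Type*} [SeminormedAddCommGroup E] {f : ℕ → E}
    (h : Tendsto (fun p : ℕ × ℕ => ‖f p.1 - f p.2‖ ^ 2) atTop (𝓝 0)) : CauchySeq f := by
  rw [cauchySeq_iff_tendsto_dist_atTop_0]
  have := h.sqrt
  simpa [dist_eq_norm] using this

/-- Both components converge by completeness. The `H^1` limit vanishes since its `L_2` part does, so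
the limit on `Γ` is a trace of `0`. -/
theorem isClosableForm_of_traceUnique {d : ℕ} {Ω : Set (Euc d)} (hΩ : IsOpen Ω)
    (hb : Bornology.IsBounded Ω) [IsFiniteMeasure (boundaryMeasure Ω)] (h : TraceUnique Ω) :
    IsClosableForm (H1Cont.toL2 Ω) (robinForm Ω) := by
  intro w hw h0
  simp only [robinForm_self_add_norm_sq hb] at hw
  simp only [map_sub] at hw
  obtain ⟨u, hu⟩ : ∃ u, Tendsto (fun n => H1Cont.toH1 Ω (w n)) atTop (𝓝 u) :=
    cauchySeq_tendsto_of_complete (cauchySeq_of_tendsto_norm_sq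
      (squeeze_zero (fun _ => sq_nonneg _) (fun _ => le_add_of_nonneg_right (sq_nonneg _)) hw))
  obtain ⟨φ, hφ⟩ : ∃ φ, Tendsto (fun n => traceMap hb (w n)) atTop (𝓝 φ) :=
    cauchySeq_tendsto_of_complete (cauchySeq_of_tendsto_norm_sq
      (squeeze_zero (fun _ => sq_nonneg _) (fun _ => le_add_of_nonneg_left (sq_nonneg _)) hw))
  have hu0 : u = 0 := H1.toL2_injective hΩ
    (tendsto_nhds_unique (((H1.continuous_toL2 Ω).tendsto u).comp hu) h0)
  subst hu0
  have hφ0 : φ = 0 := (h φ).1 ((isTrace_iff hb).2 ⟨w, hu, hφ⟩)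
  subst hφ0
  have := (tendsto_norm_sq_zero_iff.2 hu).add (tendsto_norm_sq_zero_iff.2 hφ)
  simp only [← robinForm_self_add_norm_sq hb, add_zero] at this
  refine squeeze_zero (fun n => ?_) (fun n => le_add_of_nonneg_right (sq_nonneg _)) this
  rw [robinForm_self hb]
  positivity

theorem traceUnique_of_forall_isTrace {d : ℕ} {Ω : Set (Euc d)} (hb : Bornology.IsBounded Ω)
    [IsFiniteMeasure (boundaryMeasure Ω)] (h : ∀ φ, IsTrace Ω 0 φ → φ = 0) : TraceUnique Ω :=
  fun φ => ⟨h φ, fun h0 => h0 ▸ isTrace_zero_zero hb⟩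

/-- A sequence realising `φ` as a trace of `0` is form-Cauchy and null in `L_2(Ω)`; closability then
forces its boundary values to `0`. -/
theorem traceUnique_of_isClosableForm {d : ℕ} {Ω : Set (Euc d)}
    (hb : Bornology.IsBounded Ω) [IsFiniteMeasure (boundaryMeasure Ω)]
    (h : IsClosableForm (H1Cont.toL2 Ω) (robinForm Ω)) : TraceUnique Ω := by
  refine traceUnique_of_forall_isTrace hb fun φ hφ => ?_
  obtain ⟨w, hw, hwφ⟩ := (isTrace_iff hb).1 hφ
  have hc : Tendsto (fun p : ℕ × ℕ => robinForm Ω (w p.1 - w p.2) (w p.1 - w p.2)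
      + ‖H1Cont.toL2 Ω (w p.1 - w p.2)‖ ^ 2) atTop (𝓝 0) := by
    simp only [robinForm_self_add_norm_sq hb]
    simp only [map_sub]
    have h1 := tendsto_norm_sq_zero_iff.2 (sub_self (0 : H1 Ω) ▸
      (hw.comp tendsto_fst).sub (hw.comp tendsto_snd))
    have h2 := tendsto_norm_sq_zero_iff.2 (sub_self φ ▸
      (hwφ.comp tendsto_fst).sub (hwφ.comp tendsto_snd))
    have := h1.add h2
    rw [add_zero, prod_atTop_atTop_eq] at this
    exact this
  have h0 : Tendsto (fun n => H1Cont.toL2 Ω (w n)) atTop (𝓝 0) := by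
    have := ((H1.continuous_toL2 Ω).tendsto 0).comp hw
    rwa [map_zero] at this
  have ha := h w hc h0
  have : Tendsto (fun n => traceMap hb (w n)) atTop (𝓝 0) := by
    rw [← tendsto_norm_sq_zero_iff]
    refine squeeze_zero (fun _ => sq_nonneg _) (fun n => ?_) ha
    rw [robinForm_self hb]
    exact le_add_of_nonneg_left (sq_nonneg _)
  exact tendsto_nhds_unique hwφ this

/-! ### Composition and multiplication in `H^1(Ω) ∩ C(closure Ω)`. -/

/-- A continuous function with a square integrable weak gradient is in
`H^1(Ω) ∩ C(closure Ω)`. -/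
theorem H1Cont.exists_of_hasWeakDeriv {d : ℕ} {Ω : Set (Euc d)} (hΩ : IsOpen Ω)
    {f : Euc d → ℝ} {g : Euc d → Euc d} (hf : ContinuousOn f (closure Ω))
    (hf2 : MemLp f 2 (volume.restrict Ω)) (hg : MemLp g 2 (volume.restrict Ω))
    (h : ∀ i : Fin d, HasWeakDeriv Ω (EuclideanSpace.single i 1) f (fun x => g x i)) :
    ∃ w : H1Cont Ω, (∀ x ∈ closure Ω, H1Cont.values w x = f x) ∧
      H1.grad Ω (H1Cont.toH1 Ω w) =ᵐ[volume.restrict Ω] g := by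
  have hw : IsWeakGradient Ω (hf2.toLp f) (hg.toLp g) := by
    intro φ hφ hc hs i
    have e1 : ∫ x in Ω, hf2.toLp f x * fderiv ℝ φ x (EuclideanSpace.single i 1)
        = ∫ x in Ω, f x * fderiv ℝ φ x (EuclideanSpace.single i 1) := by
      apply integral_congr_ae
      filter_upwards [hf2.coeFn_toLp] with x hx
      rw [hx]
    have e2 : ∫ x in Ω, hg.toLp g x i * φ x = ∫ x in Ω, g x i * φ x := by
      apply integral_congr_ae
      filter_upwards [hg.coeFn_toLp] with x hx
      rw [hx]
    rw [e1, e2]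
    exact h i φ hφ hc hs
  let u : H1 Ω := ⟨WithLp.toLp 2 (hf2.toLp f, hg.toLp g), hw⟩
  let F : C(closure Ω, ℝ) := ⟨(closure Ω).domRestrict f, hf.domRestrict⟩
  have hF : ∀ x ∈ closure Ω, ext F x = f x := fun x hx => ext_apply F hx
  refine ⟨⟨(u, F), ?_⟩, hF, hg.coeFn_toLp⟩
  change ∀ᵐ x ∂(volume.restrict Ω), hf2.toLp f x = ext F x
  filter_upwards [hf2.coeFn_toLp, ae_restrict_mem hΩ.measurableSet] with x hx hxΩ
  rw [hx, hF x (subset_closure hxΩ)]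

theorem H1Cont.hasWeakDeriv {d : ℕ} {Ω : Set (Euc d)} (w : H1Cont Ω) (i : Fin d) :
    HasWeakDeriv Ω (EuclideanSpace.single i 1) (H1Cont.values w)
      (fun x => H1.grad Ω (H1Cont.toH1 Ω w) x i) := by
  intro φ hφ hc hs
  have h : IsWeakGradient Ω (H1Cont.toL2 Ω w) (H1.grad Ω (H1Cont.toH1 Ω w)) :=
    (H1Cont.toH1 Ω w).2
  rw [← h φ hφ hc hs i]
  apply integral_congr_ae
  filter_upwards [H1Cont.toL2_ae_eq_values w] with x hx
  rw [hx]

theorem memLp_of_continuousOn_closure {d : ℕ} {Ω : Set (Euc d)} (hΩ : IsOpen Ω)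
    (hb : Bornology.IsBounded Ω) {f : Euc d → ℝ} (hf : ContinuousOn f (closure Ω)) (p : ℝ≥0∞) :
    MemLp f p (volume.restrict Ω) := by
  obtain ⟨C, hC⟩ := hb.isCompact_closure.exists_bound_of_continuousOn hf
  have : IsFiniteMeasure (volume.restrict Ω) := isFiniteMeasure_restrict.2 hb.measure_lt_top.ne
  refine MemLp.of_bound ((hf.mono subset_closure).aestronglyMeasurable hΩ.measurableSet) C ?_
  filter_upwards [ae_restrict_mem hΩ.measurableSet] with x hx using hC x (subset_closure hx)

/-- Composition of `w ∈ H^1(Ω) ∩ C(closure Ω)` with a smooth function. -/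
theorem H1Cont.exists_comp {d : ℕ} {Ω : Set (Euc d)} (hΩ : IsOpen Ω)
    (hb : Bornology.IsBounded Ω) {F : ℝ → ℝ} (hF : ContDiff ℝ ∞ F) (w : H1Cont Ω) :
    ∃ v : H1Cont Ω, (∀ x ∈ closure Ω, H1Cont.values v x = F (H1Cont.values w x)) ∧
      H1.grad Ω (H1Cont.toH1 Ω v) =ᵐ[volume.restrict Ω]
        fun x => deriv F (H1Cont.values w x) • H1.grad Ω (H1Cont.toH1 Ω w) x := by
  have hwc := H1Cont.continuousOn_values w
  obtain ⟨M, hM⟩ := H1Cont.exists_bound hb w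
  have hF' : Continuous (deriv F) := hF.continuous_deriv (by simp)
  have hFw : ContinuousOn (fun x => F (H1Cont.values w x)) (closure Ω) :=
    hF.continuous.comp_continuousOn hwc
  have hF'w : ContinuousOn (fun x => deriv F (H1Cont.values w x)) (closure Ω) :=
    hF'.comp_continuousOn hwc
  have : IsFiniteMeasure (volume.restrict Ω) := isFiniteMeasure_restrict.2 hb.measure_lt_top.ne
  refine H1Cont.exists_of_hasWeakDeriv hΩ hFw (memLp_of_continuousOn_closure hΩ hb hFw 2) ?_ ?_
  · exact (Lp.memLp (H1.grad Ω (H1Cont.toH1 Ω w))).smul (p := ⊤)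
      (memLp_of_continuousOn_closure hΩ hb hF'w ⊤)
  · intro i
    exact (H1Cont.hasWeakDeriv w i).comp_of_continuousOn hΩ hb (hwc.mono subset_closure)
      (fun x hx => hM x (subset_closure hx))
      ((memLp_coord Ω (H1.grad Ω (H1Cont.toH1 Ω w)) i).integrable (by norm_num)) hF

/-- As `F 0 = 0`, the bound on the derivative also gives `|F t| ≤ C |t|`, so function and gradient
both grow by at most the factor `C`. -/
theorem H1Cont.norm_comp_le {d : ℕ} {Ω : Set (Euc d)} (hΩ : IsOpen Ω) {F : ℝ → ℝ} {C : ℝ}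
    (hF : Differentiable ℝ F) (hF0 : F 0 = 0) (hC : ∀ t, ‖deriv F t‖ ≤ C) {v w : H1Cont Ω}
    (hv : ∀ x ∈ closure Ω, H1Cont.values v x = F (H1Cont.values w x))
    (hv' : H1.grad Ω (H1Cont.toH1 Ω v) =ᵐ[volume.restrict Ω]
        fun x => deriv F (H1Cont.values w x) • H1.grad Ω (H1Cont.toH1 Ω w) x) :
    ‖H1Cont.toH1 Ω v‖ ≤ C * ‖H1Cont.toH1 Ω w‖ := by
  have hC0 : 0 ≤ C := (norm_nonneg _).trans (hC 0)
  have h1 : ‖H1.toL2 Ω (H1Cont.toH1 Ω v)‖ ≤ C * ‖H1.toL2 Ω (H1Cont.toH1 Ω w)‖ := by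
    apply Lp.norm_le_mul_norm_of_ae_le_mul
    filter_upwards [H1Cont.toL2_ae_eq_values v, H1Cont.toL2_ae_eq_values w,
      ae_restrict_mem hΩ.measurableSet] with x hx1 hx2 hx
    change ‖H1Cont.toL2 Ω v x‖ ≤ C * ‖H1Cont.toL2 Ω w x‖
    rw [hx1, hx2, hv x (subset_closure hx)]
    simpa [hF0] using convex_univ.norm_image_sub_le_of_norm_deriv_le (f := F)
      (fun t _ => hF t) (fun t _ => hC t) (mem_univ 0) (mem_univ (H1Cont.values w x))
  have h2 : ‖H1.grad Ω (H1Cont.toH1 Ω v)‖ ≤ C * ‖H1.grad Ω (H1Cont.toH1 Ω w)‖ := by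
    apply Lp.norm_le_mul_norm_of_ae_le_mul
    filter_upwards [hv'] with x hx
    rw [hx, norm_smul]
    exact mul_le_mul_of_nonneg_right (hC _) (norm_nonneg _)
  refine le_of_sq_le_sq ?_ (by positivity)
  rw [mul_pow, H1.norm_sq, H1.norm_sq, mul_add, ← mul_pow, ← mul_pow]
  gcongr

theorem H1.enorm_le {d : ℕ} {Ω : Set (Euc d)} (u : H1 Ω) :
    ‖u‖ₑ ≤ eLpNorm (H1.toL2 Ω u) 2 (volume.restrict Ω)
      + eLpNorm (H1.grad Ω u) 2 (volume.restrict Ω) := by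
  rw [← Lp.enorm_def, ← Lp.enorm_def]
  have h : ‖u‖ ≤ ‖H1.toL2 Ω u‖ + ‖H1.grad Ω u‖ := by
    refine le_of_sq_le_sq ?_ (by positivity)
    rw [H1.norm_sq]
    nlinarith [norm_nonneg (H1.toL2 Ω u), norm_nonneg (H1.grad Ω u)]
  rw [← ofReal_norm, ← ofReal_norm, ← ofReal_norm, ← ENNReal.ofReal_add (norm_nonneg _) (norm_nonneg _)]
  exact ENNReal.ofReal_le_ofReal h

theorem gradient_apply {d : ℕ} (χ : Euc d → ℝ) (x : Euc d) (i : Fin d) :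
    gradient χ x i = fderiv ℝ χ x (EuclideanSpace.single i 1) := by
  rw [← toDual_gradient, InnerProductSpace.toDual_apply_apply, EuclideanSpace.inner_single_right]
  simp

/-- Multiplication of `w ∈ H^1(Ω) ∩ C(closure Ω)` with a test function on `ℝ^d`. -/
theorem H1Cont.exists_mul {d : ℕ} {Ω : Set (Euc d)} (hΩ : IsOpen Ω)
    (hb : Bornology.IsBounded Ω) {χ : Euc d → ℝ} (hχ : ContDiff ℝ ∞ χ) (w : H1Cont Ω) :
    ∃ v : H1Cont Ω, (∀ x ∈ closure Ω, H1Cont.values v x = χ x * H1Cont.values w x) ∧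
      H1.grad Ω (H1Cont.toH1 Ω v) =ᵐ[volume.restrict Ω]
        fun x => χ x • H1.grad Ω (H1Cont.toH1 Ω w) x + H1Cont.values w x • gradient χ x := by
  have hwc := H1Cont.continuousOn_values w
  have hgc : Continuous (gradient χ) :=
    (InnerProductSpace.toDual ℝ (Euc d)).symm.continuous.comp (hχ.continuous_fderiv (by simp))
  have hχw : ContinuousOn (fun x => χ x * H1Cont.values w x) (closure Ω) :=
    hχ.continuous.continuousOn.mul hwc
  have hg2 := Lp.memLp (H1.grad Ω (H1Cont.toH1 Ω w))
  have hχL := memLp_of_continuousOn_closure hΩ hb hχ.continuous.continuousOn ⊤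
  have hw2 := memLp_of_continuousOn_closure hΩ hb hwc 2
  have hgL : MemLp (gradient χ) ⊤ (volume.restrict Ω) := by
    obtain ⟨C, hC⟩ := hb.isCompact_closure.exists_bound_of_continuousOn hgc.continuousOn
    refine memLp_top_of_bound hgc.aestronglyMeasurable C ?_
    filter_upwards [ae_restrict_mem hΩ.measurableSet] with x hx using hC x (subset_closure hx)
  refine H1Cont.exists_of_hasWeakDeriv hΩ hχw (memLp_of_continuousOn_closure hΩ hb hχw 2) ?_ ?_
  · exact (hg2.smul (p := ⊤) hχL).add (hgL.smul (p := 2) hw2)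
  · intro i φ hφ hc hs
    have hφ2 : MemLp φ 2 (volume.restrict Ω) :=
      (hφ.continuous.memLp_of_hasCompactSupport hc).restrict Ω
    have hχc : HasCompactSupport fun x => χ x * φ x := hc.mul_left
    -- Testing `w` against `χ φ` and expanding its derivative gives the product rule.
    have h1 := H1Cont.hasWeakDeriv w i (fun x => χ x * φ x) (hχ.mul hφ) hχc
      ((closure_mono (Function.support_mul_subset_right _ _)).trans hs)
    have hgi := memLp_coord Ω (H1.grad Ω (H1Cont.toH1 Ω w)) i
    have cχ : Continuous fun x => fderiv ℝ χ x (EuclideanSpace.single i 1) :=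
      (hχ.continuous_fderiv (by simp)).clm_apply continuous_const
    have i1 : Integrable (fun x => χ x * H1Cont.values w x
        * fderiv ℝ φ x (EuclideanSpace.single i 1)) (volume.restrict Ω) :=
      (memLp_of_continuousOn_closure hΩ hb hχw 2).integrable_mul
        (memLp_testFunction_deriv Ω hφ hc _)
    have i2 : Integrable (fun x => H1Cont.values w x
        * fderiv ℝ χ x (EuclideanSpace.single i 1) * φ x) (volume.restrict Ω) :=
      (memLp_of_continuousOn_closure hΩ hb (hwc.mul cχ.continuousOn) 2).integrable_mul hφ2
    have i3 : Integrable (fun x => χ x * H1.grad Ω (H1Cont.toH1 Ω w) x i * φ x)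
        (volume.restrict Ω) := (hgi.smul (p := ⊤) (r := 2) hχL).integrable_mul hφ2
    have e1 : ∀ x, H1Cont.values w x
        * fderiv ℝ (fun x => χ x * φ x) x (EuclideanSpace.single i 1)
        = χ x * H1Cont.values w x * fderiv ℝ φ x (EuclideanSpace.single i 1)
          + H1Cont.values w x * fderiv ℝ χ x (EuclideanSpace.single i 1) * φ x := by
      intro x
      rw [fderiv_fun_mul (hχ.differentiable (by simp) x) (hφ.differentiable (by simp) x)]
      simp only [add_apply, smul_apply, smul_eq_mul]
      ring
    have e2 : ∀ x, (χ x • H1.grad Ω (H1Cont.toH1 Ω w) x + H1Cont.values w x • gradient χ x) i * φ x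
        = χ x * H1.grad Ω (H1Cont.toH1 Ω w) x i * φ x
          + H1Cont.values w x * fderiv ℝ χ x (EuclideanSpace.single i 1) * φ x := by
      intro x
      rw [PiLp.add_apply, PiLp.smul_apply, PiLp.smul_apply, gradient_apply, smul_eq_mul,
        smul_eq_mul, add_mul]
    have e3 : ∀ x, H1.grad Ω (H1Cont.toH1 Ω w) x i * (χ x * φ x)
        = χ x * H1.grad Ω (H1Cont.toH1 Ω w) x i * φ x := fun x => by ring
    simp only [e1, e3] at h1
    simp only [e2]
    rw [integral_add i1 i2] at h1
    rw [integral_add i3 i2]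
    linarith

theorem gradient_eq_zero_of_notMem_tsupport {d : ℕ} {χ : Euc d → ℝ} {x : Euc d}
    (hx : x ∉ tsupport χ) : gradient χ x = 0 := by
  have : fderiv ℝ χ x = 0 := by
    by_contra hne
    exact hx (support_fderiv_subset ℝ hne)
  rw [gradient, this, map_zero]

/-- The `L_2` norms of `χ f` and of `χ G + f ∇χ` are bounded by the norms of `f` and `G` on the
support of `χ`. -/
theorem eLpNorm_cutoff_le {d : ℕ} {μ : Measure (Euc d)} {χ : Euc d → ℝ} {A B : ℝ}
    (hχ : ContDiff ℝ ∞ χ) (hA : ∀ x, ‖χ x‖ ≤ A) (hB : ∀ x, ‖gradient χ x‖ ≤ B)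
    {f : Euc d → ℝ} {G : Euc d → Euc d} (hf : AEStronglyMeasurable f μ)
    (hG : AEStronglyMeasurable G μ) :
    eLpNorm (fun x => χ x * f x) 2 μ + eLpNorm (fun x => χ x • G x + f x • gradient χ x) 2 μ
      ≤ (ENNReal.ofReal A + ENNReal.ofReal B) *
        (eLpNorm f 2 (μ.restrict (tsupport χ)) + eLpNorm G 2 (μ.restrict (tsupport χ))) := by
  have hgc : Continuous (gradient χ) :=
    (InnerProductSpace.toDual ℝ (Euc d)).symm.continuous.comp (hχ.continuous_fderiv (by simp))
  have hS : MeasurableSet (tsupport χ) := (isClosed_tsupport χ).measurableSet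
  have e1 : (fun x => χ x * f x) = (tsupport χ).indicator fun x => χ x * f x := by
    ext x
    by_cases hx : x ∈ tsupport χ
    · rw [indicator_of_mem hx]
    · rw [indicator_of_notMem hx, image_eq_zero_of_notMem_tsupport hx, zero_mul]
  have e2 : (fun x => χ x • G x + f x • gradient χ x)
      = (tsupport χ).indicator fun x => χ x • G x + f x • gradient χ x := by
    ext1 x
    by_cases hx : x ∈ tsupport χ
    · rw [indicator_of_mem hx]
    · rw [indicator_of_notMem hx, image_eq_zero_of_notMem_tsupport hx,
        gradient_eq_zero_of_notMem_tsupport hx, zero_smul, smul_zero, add_zero]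
  rw [e1, e2, eLpNorm_indicator_eq_eLpNorm_restrict hS, eLpNorm_indicator_eq_eLpNorm_restrict hS]
  have hf' : AEStronglyMeasurable f (μ.restrict (tsupport χ)) := hf.restrict
  have hG' : AEStronglyMeasurable G (μ.restrict (tsupport χ)) := hG.restrict
  generalize μ.restrict (tsupport χ) = ν at hf' hG' ⊢
  have b1 : eLpNorm (fun x => χ x * f x) 2 ν ≤ ENNReal.ofReal A * eLpNorm f 2 ν := by
    refine eLpNorm_le_mul_eLpNorm_of_ae_le_mul (Eventually.of_forall fun x => ?_) 2
    rw [norm_mul]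
    exact mul_le_mul_of_nonneg_right (hA x) (norm_nonneg _)
  have b2 : eLpNorm (fun x => χ x • G x) 2 ν ≤ ENNReal.ofReal A * eLpNorm G 2 ν := by
    refine eLpNorm_le_mul_eLpNorm_of_ae_le_mul (Eventually.of_forall fun x => ?_) 2
    rw [norm_smul]
    exact mul_le_mul_of_nonneg_right (hA x) (norm_nonneg _)
  have b3 : eLpNorm (fun x => f x • gradient χ x) 2 ν ≤ ENNReal.ofReal B * eLpNorm f 2 ν := by
    refine eLpNorm_le_mul_eLpNorm_of_ae_le_mul (Eventually.of_forall fun x => ?_) 2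
    rw [norm_smul, mul_comm]
    exact mul_le_mul_of_nonneg_right (hB x) (norm_nonneg _)
  have b4 : eLpNorm (fun x => χ x • G x + f x • gradient χ x) 2 ν
      ≤ eLpNorm (fun x => χ x • G x) 2 ν + eLpNorm (fun x => f x • gradient χ x) 2 ν :=
    eLpNorm_add_le (hχ.continuous.aestronglyMeasurable.smul hG')
      (hf'.smul hgc.aestronglyMeasurable) (by norm_num)
  refine (add_le_add b1 (b4.trans (add_le_add b2 b3))).trans ?_
  rw [add_mul, mul_add, mul_add]
  exact (le_self_add (b := ENNReal.ofReal B * eLpNorm G 2 ν)).trans_eq (by ring)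

/-- The norm of `χ w` is bounded by the local norm of `w` on the support of `χ`. -/
theorem H1Cont.exists_enorm_mul_le {d : ℕ} {Ω : Set (Euc d)} (hΩ : IsOpen Ω)
    {χ : Euc d → ℝ} (hχ : ContDiff ℝ ∞ χ) (hc : HasCompactSupport χ) :
    ∃ C : ℝ≥0∞, C ≠ ⊤ ∧ ∀ v w : H1Cont Ω,
      (∀ x ∈ closure Ω, H1Cont.values v x = χ x * H1Cont.values w x) →
      H1.grad Ω (H1Cont.toH1 Ω v) =ᵐ[volume.restrict Ω]
        (fun x => χ x • H1.grad Ω (H1Cont.toH1 Ω w) x + H1Cont.values w x • gradient χ x) →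
      ‖H1Cont.toH1 Ω v‖ₑ ≤ C *
        (eLpNorm (H1Cont.values w) 2 ((volume.restrict Ω).restrict (tsupport χ))
        + eLpNorm (H1.grad Ω (H1Cont.toH1 Ω w)) 2 ((volume.restrict Ω).restrict (tsupport χ))) := by
  have hgc : Continuous (gradient χ) :=
    (InnerProductSpace.toDual ℝ (Euc d)).symm.continuous.comp (hχ.continuous_fderiv (by simp))
  obtain ⟨A, hA⟩ : ∃ A, ∀ x, ‖χ x‖ ≤ A := hc.exists_bound_of_continuous hχ.continuous
  obtain ⟨B, hB⟩ : ∃ B, ∀ x, ‖gradient χ x‖ ≤ B :=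
    (HasCompactSupport.of_support_subset_isCompact hc.isCompact (fun x hx => by_contra fun h =>
      hx (gradient_eq_zero_of_notMem_tsupport h))).exists_bound_of_continuous hgc
  refine ⟨ENNReal.ofReal A + ENNReal.ofReal B, by simp, fun v w hv hv' => ?_⟩
  have e1 : H1.toL2 Ω (H1Cont.toH1 Ω v) =ᵐ[volume.restrict Ω]
      fun x => χ x * H1Cont.values w x := by
    filter_upwards [H1Cont.toL2_ae_eq_values v, ae_restrict_mem hΩ.measurableSet] with x hx1 hx
    rw [← hv x (subset_closure hx), ← hx1]
    rfl
  refine (H1.enorm_le _).trans ?_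
  rw [eLpNorm_congr_ae e1, eLpNorm_congr_ae hv']
  exact eLpNorm_cutoff_le hχ hA hB
    (((H1Cont.continuousOn_values w).mono subset_closure).aestronglyMeasurable hΩ.measurableSet)
    (Lp.aestronglyMeasurable _)

/-! ### Smooth truncation and sets of capacity zero. -/

/-- A bound for the derivative of the smooth transition function. -/
theorem exists_norm_deriv_smoothTransition_le :
    ∃ C : ℝ, ∀ t, ‖deriv Real.smoothTransition t‖ ≤ C := by
  have hc : Continuous (deriv Real.smoothTransition) :=
    (Real.smoothTransition.contDiff (n := 1)).continuous_deriv le_rfl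
  refine (HasCompactSupport.of_support_subset_isCompact (isCompact_Icc (a := (0 : ℝ)) (b := 1))
    fun t ht => ?_).exists_bound_of_continuous hc
  by_contra h
  rw [mem_Icc, not_and_or, not_le, not_le] at h
  refine ht ?_
  rcases h with h | h
  -- Outside `[0,1]` the function takes its global minimum `0` or its global maximum `1`, so its
  -- derivative vanishes.
  · refine IsLocalMin.deriv_eq_zero (Eventually.of_forall fun s => ?_)
    rw [Real.smoothTransition.zero_of_nonpos h.le]
    exact Real.smoothTransition.nonneg s
  · refine IsLocalMax.deriv_eq_zero (Eventually.of_forall fun s => ?_)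
    rw [Real.smoothTransition.one_of_one_le h.le]
    exact Real.smoothTransition.le_one s

/-- The endpoint `t = 1` counts, because admissible functions only satisfy `u ≥ 1`. -/
theorem deriv_smoothTransition_of_one_le {t : ℝ} (ht : 1 ≤ t) :
    deriv Real.smoothTransition t = 0 := by
  refine IsLocalMax.deriv_eq_zero (Eventually.of_forall fun s => ?_)
  rw [Real.smoothTransition.one_of_one_le ht]
  exact Real.smoothTransition.le_one s

theorem exists_lt_of_relCap_eq_zero {d : ℕ} {Ω A : Set (Euc d)} (hΩ : IsOpen Ω)
    (hb : Bornology.IsBounded Ω) (h : relCap Ω A = 0) {ε : ℝ} (hε : 0 < ε) :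
    ∃ u ∈ H1Tilde Ω, ∃ V : Set (Euc d), IsOpen V ∧ A ⊆ V ∧
      (∀ᵐ x ∂(volume.restrict (Ω ∩ V)), 1 ≤ H1.toL2 Ω u x) ∧ ‖u‖ < ε := by
  -- The constant function `1` is always admissible. Without a candidate the real infimum would be
  -- `0` by default, and capacity zero would give no small function.
  obtain ⟨w, hw, -⟩ := H1Cont.exists_comp hΩ hb (F := fun _ => 1) contDiff_const (0 : H1Cont Ω)
  have hne : {r : ℝ | ∃ u ∈ H1Tilde Ω, ∃ V : Set (Euc d), IsOpen V ∧ A ⊆ V ∧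
      (∀ᵐ x ∂(volume.restrict (Ω ∩ V)), 1 ≤ H1.toL2 Ω u x) ∧ r = ‖u‖ ^ 2}.Nonempty := by
    refine ⟨_, H1Cont.toH1 Ω w, subset_closure (mem_range_self w), univ, isOpen_univ,
      subset_univ A, ?_, rfl⟩
    rw [inter_univ]
    filter_upwards [H1Cont.toL2_ae_eq_values w, ae_restrict_mem hΩ.measurableSet] with x hx hxΩ
    change 1 ≤ H1Cont.toL2 Ω w x
    rw [hx, hw x (subset_closure hxΩ)]
  obtain ⟨r, ⟨u, hu, V, hV, hAV, hu1, rfl⟩, hr⟩ :=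
    exists_lt_of_csInf_lt hne (show relCap Ω A < ε ^ 2 by rw [h]; positivity)
  exact ⟨u, hu, V, hV, hAV, hu1, lt_of_pow_lt_pow_left₀ 2 hε.le hr⟩

theorem relCap_eq_zero {d : ℕ} {Ω A : Set (Euc d)}
    (h : ∀ ε : ℝ, 0 < ε → ∃ u ∈ H1Tilde Ω, ∃ V : Set (Euc d), IsOpen V ∧ A ⊆ V ∧
      (∀ᵐ x ∂(volume.restrict (Ω ∩ V)), 1 ≤ H1.toL2 Ω u x) ∧ ‖u‖ < ε) :
    relCap Ω A = 0 := by
  have h0 : ∀ r ∈ {r : ℝ | ∃ u ∈ H1Tilde Ω, ∃ V : Set (Euc d), IsOpen V ∧ A ⊆ V ∧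
      (∀ᵐ x ∂(volume.restrict (Ω ∩ V)), 1 ≤ H1.toL2 Ω u x) ∧ r = ‖u‖ ^ 2}, 0 ≤ r := by
    rintro r ⟨u, -, V, -, -, -, rfl⟩
    positivity
  refine le_antisymm (le_of_forall_pos_le_add fun ε hε => ?_) (Real.sInf_nonneg h0)
  obtain ⟨u, hu, V, hV, hAV, hu1, hlt⟩ := h (√ε) (Real.sqrt_pos.2 hε)
  rw [zero_add]
  refine (csInf_le ⟨0, h0⟩ ⟨u, hu, V, hV, hAV, hu1, rfl⟩).trans ?_
  calc ‖u‖ ^ 2 ≤ √ε ^ 2 := by gcongr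
    _ = ε := Real.sq_sqrt hε.le

/-- A nonnegative function that is at least `1` where `|w| ≥ 1`, with norm controlled by `w`. -/
theorem H1Cont.exists_nonneg_one_le {d : ℕ} {Ω : Set (Euc d)} (hΩ : IsOpen Ω)
    (hb : Bornology.IsBounded Ω) :
    ∃ C : ℝ, 0 ≤ C ∧ ∀ w : H1Cont Ω, ∃ g : H1Cont Ω, (∀ x ∈ closure Ω, 0 ≤ H1Cont.values g x) ∧
      (∀ x ∈ closure Ω, 1 ≤ |H1Cont.values w x| → 1 ≤ H1Cont.values g x) ∧
      ‖H1Cont.toH1 Ω g‖ ≤ C * ‖H1Cont.toH1 Ω w‖ := by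
  obtain ⟨C, hC⟩ := exists_norm_deriv_smoothTransition_le
  have hs : ContDiff ℝ ∞ Real.smoothTransition := Real.smoothTransition.contDiff
  have hC0 : 0 ≤ C := (norm_nonneg _).trans (hC 0)
  refine ⟨C + C, add_nonneg hC0 hC0, fun w => ?_⟩
  -- With `s` the smooth transition, `s(w) + s(-w)` replaces the non-smooth `|w|`.
  obtain ⟨g₁, h₁, h₁'⟩ := H1Cont.exists_comp hΩ hb hs w
  obtain ⟨g₂, h₂, h₂'⟩ := H1Cont.exists_comp hΩ hb hs ((-1 : ℝ) • w)
  have hn₁ := H1Cont.norm_comp_le hΩ (hs.differentiable (by simp)) Real.smoothTransition.zero hC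
    h₁ h₁'
  have hn₂ := H1Cont.norm_comp_le hΩ (hs.differentiable (by simp)) Real.smoothTransition.zero hC
    h₂ h₂'
  rw [map_smul, neg_one_smul, norm_neg] at hn₂
  have hv : ∀ x ∈ closure Ω, H1Cont.values (g₁ + g₂) x
      = Real.smoothTransition (H1Cont.values w x) + Real.smoothTransition (-H1Cont.values w x) := by
    intro x hx
    rw [H1Cont.values_add, Pi.add_apply, h₁ x hx, h₂ x hx, H1Cont.values_smul, Pi.smul_apply,
      neg_one_smul]
  refine ⟨g₁ + g₂, fun x hx => ?_, fun x hx h1 => ?_, ?_⟩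
  · rw [hv x hx]
    exact add_nonneg (Real.smoothTransition.nonneg _) (Real.smoothTransition.nonneg _)
  · rw [hv x hx]
    rcases le_abs.1 h1 with h | h
    · rw [Real.smoothTransition.one_of_one_le h]
      linarith [Real.smoothTransition.nonneg (-H1Cont.values w x)]
    · rw [Real.smoothTransition.one_of_one_le h]
      linarith [Real.smoothTransition.nonneg (H1Cont.values w x)]
  · rw [map_add, add_mul]
    exact (norm_add_le _ _).trans (add_le_add hn₁ hn₂)

/-! ### From capacity to uniqueness of the trace. -/

/-- A Borel-Cantelli lemma for the relative capacity. -/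
theorem ae_eventually_abs_values_le_one {d : ℕ} {Ω : Set (Euc d)} (hΩ : IsOpen Ω)
    (hb : Bornology.IsBounded Ω)
    (hcap : ∀ B : Set (Euc d), B ⊆ frontier Ω → MeasurableSet B → relCap Ω B = 0 →
      boundaryMeasure Ω B = 0)
    {w : ℕ → H1Cont Ω} (hw : ∀ n, ‖H1Cont.toH1 Ω (w n)‖ ≤ (1 / 2) ^ n) :
    ∀ᵐ x ∂(boundaryMeasure Ω), ∀ᶠ n in atTop, |H1Cont.values (w n) x| ≤ 1 := by
  obtain ⟨C, hC0, hC⟩ := H1Cont.exists_nonneg_one_le hΩ hb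
  choose g hg0 hg1 hgn using fun n => hC (w n)
  -- The set `|w n| > 1` is only relatively open in `closure Ω`, while the capacity asks for
  -- neighbourhoods open in `ℝ^d`.
  have hO : ∀ n, ∃ O : Set (Euc d), IsOpen O ∧
      (fun x => |H1Cont.values (w n) x|) ⁻¹' Ioi 1 ∩ closure Ω = O ∩ closure Ω := fun n =>
    continuousOn_iff'.1 (H1Cont.continuousOn_values (w n)).abs _ isOpen_Ioi
  choose O hOo hOe using hO
  have hOiff : ∀ n, ∀ x ∈ closure Ω, x ∈ O n ↔ 1 < |H1Cont.values (w n) x| := by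
    intro n x hx
    have := Set.ext_iff.1 (hOe n) x
    simpa [hx] using this.symm
  set V : ℕ → Set (Euc d) := fun m => ⋃ n, O (n + m)
  have hVo : ∀ m, IsOpen (V m) := fun m => isOpen_iUnion fun n => hOo (n + m)
  have hB : boundaryMeasure Ω (⋂ m, frontier Ω ∩ V m) = 0 := by
    refine hcap _ ((iInter_subset _ 0).trans inter_subset_left)
      (MeasurableSet.iInter fun m => isClosed_frontier.measurableSet.inter (hVo m).measurableSet)
      (relCap_eq_zero fun ε hε => ?_)
    have hgn' : ∀ m n, ‖H1Cont.toH1 Ω (g (n + m))‖ ≤ C * (1 / 2) ^ m * (1 / 2) ^ n := by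
      intro m n
      refine (hgn (n + m)).trans ?_
      rw [mul_assoc, ← pow_add, add_comm m n]
      exact mul_le_mul_of_nonneg_left (hw _) hC0
    have hsum : ∀ m, HasSum (fun n : ℕ => C * (1 / 2) ^ m * (1 / 2 : ℝ) ^ n)
        (C * (1 / 2) ^ m * 2) := fun m => hasSum_geometric_two.mul_left _
    obtain ⟨m, hm⟩ : ∃ m : ℕ, C * (1 / 2) ^ m * 2 < ε := by
      have : Tendsto (fun m : ℕ => C * (1 / 2 : ℝ) ^ m * 2) atTop (𝓝 (C * 0 * 2)) :=
        ((tendsto_pow_atTop_nhds_zero_of_lt_one (by norm_num) (by norm_num)).const_mul C).mul_const 2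
      rw [mul_zero, zero_mul] at this
      exact (this.eventually (gt_mem_nhds hε)).exists
    have hs : Summable fun n => H1Cont.toH1 Ω (g (n + m)) :=
      Summable.of_norm_bounded (hsum m).summable (hgn' m)
    -- The infinite sum need not be continuous up to the boundary; this is where capacity candidates
    -- from the closure are needed.
    have hmem : ∑' n, H1Cont.toH1 Ω (g (n + m)) ∈ H1Tilde Ω := by
      refine mem_closure_of_tendsto hs.hasSum.tendsto_sum_nat (Eventually.of_forall fun N => ?_)
      exact ⟨∑ n ∈ Finset.range N, g (n + m), map_sum _ _ _⟩
    refine ⟨_, hmem, V m, hVo m, (iInter_subset _ m).trans inter_subset_right, ?_,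
      (tsum_of_norm_bounded (hsum m) (hgn' m)).trans_lt hm⟩
    have hL2 : HasSum (fun n => H1Cont.toL2 Ω (g (n + m)))
        (H1.toL2 Ω (∑' n, H1Cont.toH1 Ω (g (n + m)))) :=
      hs.hasSum.map (H1.toL2 Ω) (H1.continuous_toL2 Ω)
    have hnn : ∀ n, 0 ≤ H1Cont.toL2 Ω (g n) := by
      intro n
      rw [← Lp.coeFn_nonneg]
      filter_upwards [H1Cont.toL2_ae_eq_values (g n), ae_restrict_mem hΩ.measurableSet]
        with x hx hxΩ
      rw [hx]
      exact hg0 n x (subset_closure hxΩ)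
    -- All terms are nonnegative, so the sum dominates each one and hence is at least `1` on `Ω ∩ V
    -- m`.
    have hle : ∀ n, ∀ᵐ x ∂(volume.restrict Ω), H1Cont.values (g (n + m)) x
        ≤ H1.toL2 Ω (∑' n, H1Cont.toH1 Ω (g (n + m))) x := by
      intro n
      have h := le_hasSum hL2 n fun j _ => hnn _
      rw [← Lp.coeFn_le] at h
      filter_upwards [h, H1Cont.toL2_ae_eq_values (g (n + m))] with x hx1 hx2
      rwa [← hx2]
    have hle' := ae_mono (Measure.restrict_mono (inter_subset_left (s := Ω) (t := V m)) le_rfl)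
      (ae_all_iff.2 hle)
    filter_upwards [hle', ae_restrict_mem (hΩ.measurableSet.inter (hVo m).measurableSet)]
      with x hx hxm
    obtain ⟨n, hn⟩ := mem_iUnion.1 hxm.2
    have hxc := subset_closure hxm.1
    exact (hg1 _ x hxc ((hOiff _ x hxc).1 hn).le).trans (hx n)
  filter_upwards [ae_mem_frontier Ω, measure_eq_zero_iff_ae_notMem.1 hB] with x hx hxB
  simp only [mem_iInter, not_forall] at hxB
  obtain ⟨m, hm⟩ := hxB
  filter_upwards [eventually_ge_atTop m] with n hn
  by_contra hlt
  push Not at hlt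
  refine hm ⟨hx, mem_iUnion.2 ⟨n - m, ?_⟩⟩
  rw [Nat.sub_add_cancel hn]
  exact (hOiff n x (frontier_subset_closure hx)).2 hlt

theorem traceUnique_of_relCap {d : ℕ} {Ω : Set (Euc d)} (hΩ : IsOpen Ω)
    (hb : Bornology.IsBounded Ω) [IsFiniteMeasure (boundaryMeasure Ω)]
    (hcap : ∀ B : Set (Euc d), B ⊆ frontier Ω → MeasurableSet B → relCap Ω B = 0 →
      boundaryMeasure Ω B = 0) : TraceUnique Ω := by
  refine traceUnique_of_forall_isTrace hb fun φ hφ => ?_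
  obtain ⟨w, hw, hwφ⟩ := (isTrace_iff hb).1 hφ
  obtain ⟨ns, hns, hae⟩ := (tendstoInMeasure_of_tendsto_Lp hwφ).exists_seq_tendsto_ae
  -- The extra factor `1/(n+1)` leaves room to multiply by `n+1`, turning the Borel-Cantelli bound
  -- `1` into decay.
  have hk : ∀ n : ℕ, ∃ k ≥ n, ‖H1Cont.toH1 Ω (w (ns k))‖ < (1 / 2) ^ n / ((n : ℝ) + 1) := by
    intro n
    have h1 : Tendsto (fun k => ‖H1Cont.toH1 Ω (w (ns k))‖) atTop (𝓝 0) := by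
      simpa using (hw.comp hns.tendsto_atTop).norm
    exact ((eventually_ge_atTop n).and (h1.eventually (gt_mem_nhds (by positivity)))).exists
  choose k hkn hk using hk
  have hkt : Tendsto k atTop atTop := tendsto_atTop_mono hkn tendsto_id
  have hev := ae_eventually_abs_values_le_one hΩ hb hcap
    (w := fun n => ((n : ℝ) + 1) • w (ns (k n))) (fun n => by
      have hn : (0 : ℝ) < (n : ℝ) + 1 := by positivity
      rw [map_smul, norm_smul, Real.norm_of_nonneg hn.le, mul_comm]
      exact ((lt_div_iff₀ hn).1 (hk n)).le)
  rw [Lp.eq_zero_iff_ae_eq_zero]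
  have htr : ∀ᵐ x ∂(boundaryMeasure Ω), ∀ n, traceMap hb (w n) x = H1Cont.values (w n) x :=
    ae_all_iff.2 fun n => traceMap_ae_eq hb (w n)
  filter_upwards [hae, hev, htr] with x h1 h2 h3
  refine tendsto_nhds_unique (h1.comp hkt) (squeeze_zero_norm' (a := fun n : ℕ => 1 / ((n : ℝ) + 1))
    ?_ tendsto_one_div_add_atTop_nhds_zero_nat)
  filter_upwards [h2] with n hn
  have hn0 : (0 : ℝ) < (n : ℝ) + 1 := by positivity
  rw [H1Cont.values_smul, Pi.smul_apply, smul_eq_mul, abs_mul, abs_of_pos hn0] at hn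
  rw [Function.comp_apply, h3, le_div_iff₀ hn0, Real.norm_eq_abs, mul_comm]
  exact hn

/-! ### Functions of small norm equal to `1` on a compact set. -/

/-- Dominated convergence in `L_2`. -/
theorem tendsto_eLpNorm_two_zero_of_dominated {α E : Type*} [MeasurableSpace α]
    [NormedAddCommGroup E] {μ : Measure α} {f : ℕ → α → E} {g : α → ℝ}
    (hf : ∀ n, AEStronglyMeasurable (f n) μ) (hg : MemLp g 2 μ)
    (hfg : ∀ n, ∀ᵐ x ∂μ, ‖f n x‖ ≤ ‖g x‖)
    (hlim : ∀ᵐ x ∂μ, Tendsto (fun n => f n x) atTop (𝓝 0)) :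
    Tendsto (fun n => eLpNorm (f n) 2 μ) atTop (𝓝 0) := by
  have h2 : (2 : ℝ≥0∞) ≠ 0 := by norm_num
  have h2' : (2 : ℝ≥0∞) ≠ ⊤ := by norm_num
  have h : Tendsto (fun n => ∫⁻ x, ‖f n x‖ₑ ^ (2 : ℝ) ∂μ) atTop (𝓝 (∫⁻ _, 0 ∂μ)) := by
    refine tendsto_lintegral_of_dominated_convergence' (fun x => ‖g x‖ₑ ^ (2 : ℝ))
      (fun n => (hf n).enorm.pow_const _) (fun n => ?_) ?_ ?_
    · filter_upwards [hfg n] with x hx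
      exact ENNReal.rpow_le_rpow (enorm_le_iff_norm_le.2 hx) (by norm_num)
    · have := (eLpNorm_lt_top_iff_lintegral_rpow_enorm_lt_top h2 h2').1 hg.2
      simpa using this.ne
    · filter_upwards [hlim] with x hx
      have h0 : Tendsto (fun n => ‖f n x‖ₑ) atTop (𝓝 0) := by simpa using hx.enorm
      have := (ENNReal.continuous_rpow_const (y := (2 : ℝ))).tendsto 0 |>.comp h0
      rw [ENNReal.zero_rpow_of_pos (by norm_num)] at this
      exact this
  rw [lintegral_zero] at h
  have h' := (ENNReal.continuous_rpow_const (y := (1 / 2 : ℝ))).tendsto 0 |>.comp h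
  simp only [eLpNorm_eq_lintegral_rpow_enorm_toReal h2 h2', ENNReal.toReal_ofNat]
  rw [ENNReal.zero_rpow_of_pos (by norm_num)] at h'
  exact h'

/-- Lipschitz functions of an `L_2` convergent sequence converge to `0` where the limit is in the
zero set of the function. -/
theorem tendsto_eLpNorm_lipschitz_comp {α : Type*} [MeasurableSpace α] {μ ν : Measure α}
    (hν : ν ≤ μ) {F : ℝ → ℝ} {C : ℝ} (hF : ∀ s t, ‖F s - F t‖ ≤ C * ‖s - t‖)
    {f : ℕ → Lp ℝ 2 μ} {u : Lp ℝ 2 μ} (hf : Tendsto f atTop (𝓝 u)) (hu : ∀ᵐ x ∂ν, F (u x) = 0) :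
    Tendsto (fun n => eLpNorm (fun x => F (f n x)) 2 ν) atTop (𝓝 0) := by
  rw [Lp.tendsto_Lp_iff_tendsto_eLpNorm'] at hf
  have h0 := ENNReal.Tendsto.const_mul (a := ENNReal.ofReal C) hf (Or.inr ENNReal.ofReal_ne_top)
  rw [mul_zero] at h0
  refine tendsto_of_tendsto_of_tendsto_of_le_of_le tendsto_const_nhds h0
    (fun _ => zero_le) fun n => ?_
  refine (eLpNorm_le_mul_eLpNorm_of_ae_le_mul (c := C) (g := ⇑(f n) - ⇑u) ?_ 2).trans
    (mul_le_mul_right (eLpNorm_mono_measure _ hν) _)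
  filter_upwards [hu] with x hx
  simpa [hx] using hF (f n x) (u x)

/-- Convergence of products `F(w_n) G_n` with `G_n` convergent in `L_2` and `F(w_n)` bounded and
tending to `0` almost everywhere. -/
theorem tendsto_eLpNorm_comp_smul {α E : Type*} [MeasurableSpace α] [NormedAddCommGroup E]
    [NormedSpace ℝ E] {μ ν : Measure α} (hν : ν ≤ μ) {F : ℝ → ℝ} {C : ℝ} (hFc : Continuous F)
    (hF : ∀ t, ‖F t‖ ≤ C) {w : ℕ → α → ℝ} {u : α → ℝ} (hw : ∀ n, AEStronglyMeasurable (w n) μ)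
    (hwu : ∀ᵐ x ∂μ, Tendsto (fun n => w n x) atTop (𝓝 (u x))) (hu : ∀ᵐ x ∂ν, F (u x) = 0)
    {G : ℕ → Lp E 2 μ} {H : Lp E 2 μ} (hG : Tendsto G atTop (𝓝 H)) :
    Tendsto (fun n => eLpNorm (fun x => F (w n x) • G n x) 2 ν) atTop (𝓝 0) := by
  have hC0 : 0 ≤ C := (norm_nonneg _).trans (hF 0)
  have hm : ∀ n, AEStronglyMeasurable (fun x => F (w n x)) ν := fun n =>
    (hFc.comp_aestronglyMeasurable (hw n)).mono_measure hν
  have hGm : ∀ n, AEStronglyMeasurable (G n) ν := fun n =>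
    (Lp.aestronglyMeasurable _).mono_measure hν
  have hHm : AEStronglyMeasurable H ν := (Lp.aestronglyMeasurable _).mono_measure hν
  have l1 : Tendsto (fun n => eLpNorm (fun x => F (w n x) • H x) 2 ν) atTop (𝓝 0) := by
    refine tendsto_eLpNorm_two_zero_of_dominated (fun n => (hm n).smul hHm)
      (((Lp.memLp H).norm.const_mul C).mono_measure hν) (fun n => ?_) ?_
    · refine Eventually.of_forall fun x => ?_
      rw [norm_smul, norm_mul, norm_norm, Real.norm_of_nonneg hC0]
      exact mul_le_mul_of_nonneg_right (hF _) (norm_nonneg _)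
    · filter_upwards [ae_mono hν hwu, hu] with x h1 h2
      have := ((hFc.tendsto _).comp h1).smul_const (H x)
      rwa [h2, zero_smul] at this
  rw [Lp.tendsto_Lp_iff_tendsto_eLpNorm'] at hG
  have l2 := ENNReal.Tendsto.const_mul (a := ENNReal.ofReal C) hG (Or.inr ENNReal.ofReal_ne_top)
  rw [mul_zero] at l2
  have l3 := l1.add l2
  rw [add_zero] at l3
  refine tendsto_of_tendsto_of_tendsto_of_le_of_le tendsto_const_nhds l3
    (fun _ => zero_le) fun n => ?_
  -- The fixed limit `H` is handled by dominated convergence, the difference `G n - H` by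
  -- boundedness of `F`.
  have hsplit : (fun x => F (w n x) • G n x)
      = (fun x => F (w n x) • H x) + fun x => F (w n x) • (⇑(G n) - ⇑H) x := by
    ext1 x
    rw [Pi.add_apply, Pi.sub_apply, ← smul_add, add_sub_cancel]
  rw [hsplit]
  refine (eLpNorm_add_le ((hm n).smul hHm) ((hm n).smul ((hGm n).sub hHm)) (by norm_num)).trans
    (add_le_add_right ?_ _)
  refine (eLpNorm_le_mul_eLpNorm_of_ae_le_mul (c := C) (Eventually.of_forall fun x => ?_) 2).trans
    (mul_le_mul_right (eLpNorm_mono_measure _ hν) _)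
  rw [Pi.smul_apply', norm_smul]
  exact mul_le_mul_of_nonneg_right (hF _) (norm_nonneg _)

/-- Smooth cutoff functions. -/
theorem exists_cutoff {d : ℕ} {K V : Set (Euc d)} (hK : IsCompact K) (hV : IsOpen V)
    (hKV : K ⊆ V) :
    ∃ χ : Euc d → ℝ, ContDiff ℝ ∞ χ ∧ HasCompactSupport χ ∧ tsupport χ ⊆ V ∧
      (∀ x, χ x ∈ Icc (0 : ℝ) 1) ∧ ∀ x ∈ K, χ x = 1 := by
  obtain ⟨L, hL, hKL, hLV⟩ := exists_compact_between hK hV hKV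
  obtain ⟨χ, hχ, hr, hs, h1⟩ := exists_contMDiff_support_eq_eq_one_iff (n := (⊤ : ℕ∞)) 𝓘(ℝ, Euc d)
    isOpen_interior hK.isClosed hKL
  have ht : tsupport χ ⊆ L := by
    rw [tsupport, hs]
    exact closure_minimal interior_subset hL.isClosed
  exact ⟨χ, hχ.contDiff, hL.of_isClosed_subset (isClosed_tsupport χ) ht, ht.trans hLV,
    fun x => hr (mem_range_self x), fun x hx => (h1 x).1 hx⟩

/-- Functions of small norm that are equal to `1` on a compact set of small capacity. -/
theorem H1Cont.exists_eq_one {d : ℕ} {Ω : Set (Euc d)} (hΩ : IsOpen Ω)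
    (hb : Bornology.IsBounded Ω) {C : ℝ} (hC : ∀ t, ‖deriv Real.smoothTransition t‖ ≤ C)
    {u : H1 Ω} (hu : u ∈ H1Tilde Ω) {K V : Set (Euc d)} (hK : IsCompact K) (hV : IsOpen V)
    (hKV : K ⊆ V) (hu1 : ∀ᵐ x ∂(volume.restrict (Ω ∩ V)), 1 ≤ H1.toL2 Ω u x)
    {δ : ℝ} (hδ : C * ‖u‖ < δ) :
    ∃ z : H1Cont Ω, (∀ x ∈ closure Ω, H1Cont.values z x ∈ Icc (0 : ℝ) 1) ∧
      (∀ x ∈ closure Ω, x ∈ K → H1Cont.values z x = 1) ∧ ‖H1Cont.toH1 Ω z‖ < δ := by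
  obtain ⟨χ, hχ, hχc, hχV, hχ01, hχ1⟩ := exists_cutoff hK hV hKV
  have hs : ContDiff ℝ ∞ Real.smoothTransition := Real.smoothTransition.contDiff
  have hsd : Differentiable ℝ Real.smoothTransition := hs.differentiable (by simp)
  have hC0 : 0 ≤ C := (norm_nonneg _).trans (hC 0)
  obtain ⟨w, hwu, hwae⟩ : ∃ w : ℕ → H1Cont Ω,
      Tendsto (fun n => H1Cont.toH1 Ω (w n)) atTop (𝓝 u) ∧
      ∀ᵐ x ∂(volume.restrict Ω), Tendsto (fun n => H1Cont.values (w n) x) atTop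
        (𝓝 (H1.toL2 Ω u x)) := by
    obtain ⟨v, hv, hvu⟩ := mem_closure_iff_seq_limit.1 hu
    choose w hw using hv
    obtain rfl : (fun n => H1Cont.toH1 Ω (w n)) = v := funext hw
    have hL : Tendsto (fun n => H1Cont.toL2 Ω (w n)) atTop (𝓝 (H1.toL2 Ω u)) :=
      ((H1.continuous_toL2 Ω).tendsto u).comp hvu
    obtain ⟨ns, hns, hae⟩ := (tendstoInMeasure_of_tendsto_Lp hL).exists_seq_tendsto_ae
    refine ⟨fun n => w (ns n), hvu.comp hns.tendsto_atTop, ?_⟩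
    have hv : ∀ᵐ x ∂(volume.restrict Ω), ∀ n, H1Cont.toL2 Ω (w n) x = H1Cont.values (w n) x :=
      ae_all_iff.2 fun n => H1Cont.toL2_ae_eq_values (w n)
    filter_upwards [hae, hv] with x h1 h2
    simpa only [h2] using h1
  have hF1 : ContDiff ℝ ∞ fun t => 1 - Real.smoothTransition t := contDiff_const.sub hs
  have hdF1 : ∀ t, deriv (fun t => 1 - Real.smoothTransition t) t
      = - deriv Real.smoothTransition t := fun t => deriv_const_sub 1
  -- With `s` the smooth transition, the candidate is `s(w n) + χ (1 - s(w n))`: exactly `1` where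
  -- `χ = 1`. The correction `v n = χ (1 - s(w n))` tends to `0` in `H^1(Ω)`, since on `Ω ∩ tsupport
  -- χ` the limit `u` is at least `1`, where both `1 - s` and its derivative vanish.
  choose f hf hfg using fun n => H1Cont.exists_comp hΩ hb hs (w n)
  choose y hy hyg using fun n => H1Cont.exists_comp hΩ hb hF1 (w n)
  choose v hv hvg using fun n => H1Cont.exists_mul hΩ hb hχ (y n)
  obtain ⟨A, hA, hvA⟩ := H1Cont.exists_enorm_mul_le hΩ hχ hχc
  set ν := ((volume : Measure (Euc d)).restrict Ω).restrict (tsupport χ) with hν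
  have hνΩ : ν ≤ volume.restrict Ω := Measure.restrict_le_self
  have hνu : ∀ᵐ x ∂ν, 1 ≤ H1.toL2 Ω u x := by
    refine ae_mono ?_ hu1
    rw [hν, Measure.restrict_restrict (isClosed_tsupport χ).measurableSet, inter_comm]
    exact Measure.restrict_mono (inter_subset_inter_right _ hχV) le_rfl
  have hνmem : ∀ᵐ x ∂ν, x ∈ Ω := ae_mono hνΩ (ae_restrict_mem hΩ.measurableSet)
  have lim1 : Tendsto (fun n => eLpNorm (H1Cont.values (y n)) 2 ν) atTop (𝓝 0) := by
    have hL : Tendsto (fun n => H1Cont.toL2 Ω (w n)) atTop (𝓝 (H1.toL2 Ω u)) :=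
      ((H1.continuous_toL2 Ω).tendsto u).comp hwu
    refine (tendsto_eLpNorm_lipschitz_comp hνΩ (F := fun t => 1 - Real.smoothTransition t)
      (C := C) (fun s t => ?_) hL ?_).congr fun n => eLpNorm_congr_ae ?_
    · refine convex_univ.norm_image_sub_le_of_norm_deriv_le
        (fun t _ => hF1.differentiable (by simp) t) (fun t _ => ?_) (mem_univ _) (mem_univ _)
      rw [hdF1, norm_neg]
      exact hC t
    · filter_upwards [hνu] with x hx
      rw [Real.smoothTransition.one_of_one_le hx, sub_self]
    · filter_upwards [hνmem, ae_mono hνΩ (H1Cont.toL2_ae_eq_values (w n))] with x h2 h3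
      rw [hy n x (subset_closure h2), h3]
  have lim2 : Tendsto (fun n => eLpNorm (H1.grad Ω (H1Cont.toH1 Ω (y n))) 2 ν) atTop (𝓝 0) := by
    have hG : Tendsto (fun n => H1.grad Ω (H1Cont.toH1 Ω (w n))) atTop (𝓝 (H1.grad Ω u)) :=
      ((H1.continuous_grad Ω).tendsto u).comp hwu
    refine (tendsto_eLpNorm_comp_smul hνΩ (F := deriv fun t => 1 - Real.smoothTransition t)
      (C := C) (hF1.continuous_deriv (by simp)) (fun t => ?_) (fun n => ?_) hwae ?_ hG).congr
      fun n => eLpNorm_congr_ae (EventuallyEq.symm (ae_mono hνΩ (hyg n)))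
    · rw [hdF1, norm_neg]
      exact hC t
    · exact ((H1Cont.continuousOn_values (w n)).mono subset_closure).aestronglyMeasurable
        hΩ.measurableSet
    · filter_upwards [hνu] with x hx
      rw [hdF1, deriv_smoothTransition_of_one_le hx, neg_zero]
  have limv : Tendsto (fun n => ‖H1Cont.toH1 Ω (v n)‖) atTop (𝓝 0) := by
    rw [← tendsto_zero_iff_norm_tendsto_zero, tendsto_zero_iff_enorm_tendsto_zero]
    have h := ENNReal.Tendsto.const_mul (a := A) (lim1.add lim2) (Or.inr hA)
    rw [add_zero, mul_zero] at h
    exact tendsto_of_tendsto_of_tendsto_of_le_of_le tendsto_const_nhds h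
      (fun _ => zero_le) fun n => hvA (v n) (y n) (hv n) (hvg n)
  have limz : Tendsto (fun n => C * ‖H1Cont.toH1 Ω (w n)‖ + ‖H1Cont.toH1 Ω (v n)‖) atTop
      (𝓝 (C * ‖u‖ + 0)) := (hwu.norm.const_mul C).add limv
  rw [add_zero] at limz
  obtain ⟨n, hn⟩ := (limz.eventually (gt_mem_nhds hδ)).exists
  have hz : ∀ x ∈ closure Ω, H1Cont.values (f n + v n) x
      = Real.smoothTransition (H1Cont.values (w n) x)
        + χ x * (1 - Real.smoothTransition (H1Cont.values (w n) x)) := by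
    intro x hx
    rw [H1Cont.values_add, Pi.add_apply, hf n x hx, hv n x hx, hy n x hx]
  refine ⟨f n + v n, fun x hx => ?_, fun x hx hxK => ?_, ?_⟩
  -- The value is the convex combination `(1 - χ) s + χ` of `s` and `1`.
  · rw [hz x hx]
    have h1 := hχ01 x
    have h2 := Real.smoothTransition.nonneg (H1Cont.values (w n) x)
    have h3 := Real.smoothTransition.le_one (H1Cont.values (w n) x)
    constructor <;> nlinarith [h1.1, h1.2]
  · rw [hz x hx, hχ1 x hxK]
    ring
  · rw [map_add]
    exact ((norm_add_le _ _).trans (add_le_add_left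
      (H1Cont.norm_comp_le hΩ hsd Real.smoothTransition.zero hC (hf n) (hfg n)) _)).trans_lt hn

/-! ### From uniqueness of the trace to capacity. -/

/-- Multiplication with a test function is bounded for the norm of `H^1(Ω)`. -/
theorem H1Cont.exists_bounded_mul {d : ℕ} {Ω : Set (Euc d)} (hΩ : IsOpen Ω)
    (hb : Bornology.IsBounded Ω) {χ : Euc d → ℝ} (hχ : ContDiff ℝ ∞ χ)
    (hc : HasCompactSupport χ) :
    ∃ C : ℝ, 0 ≤ C ∧ ∀ w : H1Cont Ω, ∃ v : H1Cont Ω,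
      (∀ x ∈ closure Ω, H1Cont.values v x = χ x * H1Cont.values w x) ∧
      ‖H1Cont.toH1 Ω v‖ ≤ C * ‖H1Cont.toH1 Ω w‖ := by
  obtain ⟨A, hA, h⟩ := H1Cont.exists_enorm_mul_le hΩ hχ hc
  refine ⟨A.toReal * 2, by positivity, fun w => ?_⟩
  obtain ⟨v, hv, hv'⟩ := H1Cont.exists_mul hΩ hb hχ w
  refine ⟨v, hv, ?_⟩
  have hle : ‖H1.toL2 Ω (H1Cont.toH1 Ω w)‖ ≤ ‖H1Cont.toH1 Ω w‖
      ∧ ‖H1.grad Ω (H1Cont.toH1 Ω w)‖ ≤ ‖H1Cont.toH1 Ω w‖ := by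
    have := H1.norm_sq (H1Cont.toH1 Ω w)
    constructor <;> refine le_of_sq_le_sq ?_ (norm_nonneg _) <;> rw [this]
    · exact le_add_of_nonneg_right (sq_nonneg _)
    · exact le_add_of_nonneg_left (sq_nonneg _)
  have h1 : eLpNorm (H1Cont.values w) 2 ((volume.restrict Ω).restrict (tsupport χ))
      ≤ ‖H1Cont.toH1 Ω w‖ₑ := by
    refine (eLpNorm_mono_measure _ Measure.restrict_le_self).trans ?_
    rw [← eLpNorm_congr_ae (H1Cont.toL2_ae_eq_values w), ← Lp.enorm_def]
    exact enorm_le_iff_norm_le.2 hle.1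
  have h2 : eLpNorm (H1.grad Ω (H1Cont.toH1 Ω w)) 2 ((volume.restrict Ω).restrict (tsupport χ))
      ≤ ‖H1Cont.toH1 Ω w‖ₑ := by
    refine (eLpNorm_mono_measure _ Measure.restrict_le_self).trans ?_
    rw [← Lp.enorm_def]
    exact enorm_le_iff_norm_le.2 hle.2
  have h3 := (h v w hv hv').trans (mul_le_mul_right (add_le_add h1 h2) A)
  rw [← two_mul, ← mul_assoc] at h3
  have h4 := ENNReal.toReal_mono (by finiteness) h3
  simpa using h4

/-- The indicator of `K` is exhibited as a trace of `0`, via functions equal to `1` on `K`,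
supported ever closer to `K`, and tending to `0` in `H^1(Ω)`. -/
theorem boundaryMeasure_eq_zero_of_isCompact {d : ℕ} {Ω : Set (Euc d)} (hΩ : IsOpen Ω)
    (hb : Bornology.IsBounded Ω) [IsFiniteMeasure (boundaryMeasure Ω)] (h : TraceUnique Ω)
    {B K : Set (Euc d)} (hB : relCap Ω B = 0) (hKB : K ⊆ B) (hK : IsCompact K) :
    boundaryMeasure Ω K = 0 := by
  rcases K.eq_empty_or_nonempty with rfl | hKne
  · exact measure_empty
  obtain ⟨C, hC⟩ := exists_norm_deriv_smoothTransition_le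
  have hC0 : 0 ≤ C := (norm_nonneg _).trans (hC 0)
  have hsmall : ∀ δ : ℝ, 0 < δ → ∃ z : H1Cont Ω,
      (∀ x ∈ closure Ω, H1Cont.values z x ∈ Icc (0 : ℝ) 1) ∧
      (∀ x ∈ closure Ω, x ∈ K → H1Cont.values z x = 1) ∧ ‖H1Cont.toH1 Ω z‖ < δ := by
    intro δ hδ
    -- Dividing by `C + 1` rather than `C` covers `C = 0`; the same device is used for `A` below.
    obtain ⟨u, hu, V, hV, hBV, hu1, hlt⟩ :=
      exists_lt_of_relCap_eq_zero hΩ hb hB (ε := δ / (C + 1)) (by positivity)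
    refine H1Cont.exists_eq_one hΩ hb hC hu hK hV (hKB.trans hBV) hu1 ?_
    rw [lt_div_iff₀ (by positivity)] at hlt
    nlinarith [norm_nonneg u]
  have hex : ∀ m : ℕ, ∃ z : H1Cont Ω,
      (∀ x ∈ closure Ω, H1Cont.values z x ∈ Icc (0 : ℝ) 1) ∧
      (∀ x ∈ closure Ω, x ∈ K → H1Cont.values z x = 1) ∧
      (∀ x ∈ closure Ω, x ∉ Metric.thickening (1 / ((m : ℝ) + 1)) K → H1Cont.values z x = 0) ∧
      ‖H1Cont.toH1 Ω z‖ ≤ 1 / ((m : ℝ) + 1) := by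
    intro m
    have hm : (0 : ℝ) < 1 / ((m : ℝ) + 1) := by positivity
    obtain ⟨χ, hχ, hχc, hχV, hχ01, hχ1⟩ :=
      exists_cutoff hK Metric.isOpen_thickening (Metric.self_subset_thickening hm K)
    obtain ⟨A, hA, hmul⟩ := H1Cont.exists_bounded_mul hΩ hb hχ hχc
    -- The cutoff is fixed first: its multiplier bound `A` depends on `m` and is not controlled
    -- uniformly, so `z` is chosen small relative to it.
    obtain ⟨z, hz01, hz1, hzn⟩ := hsmall (1 / ((m : ℝ) + 1) / (A + 1)) (by positivity)
    obtain ⟨v, hv, hvn⟩ := hmul z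
    refine ⟨v, fun x hx => ?_, fun x hx hxK => ?_, fun x hx hxK => ?_, ?_⟩
    · rw [hv x hx]
      exact ⟨mul_nonneg (hχ01 x).1 (hz01 x hx).1,
        mul_le_one₀ (hχ01 x).2 (hz01 x hx).1 (hz01 x hx).2⟩
    · rw [hv x hx, hχ1 x hxK, hz1 x hx hxK, one_mul]
    · rw [hv x hx, image_eq_zero_of_notMem_tsupport fun h => hxK (hχV h), zero_mul]
    · rw [lt_div_iff₀ (by positivity)] at hzn
      nlinarith [norm_nonneg (H1Cont.toH1 Ω z)]
  choose z hz01 hz1 hz0 hzn using hex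
  have hKm : MeasurableSet K := hK.isClosed.measurableSet
  have hind : MemLp (K.indicator fun _ => (1 : ℝ)) 2 (boundaryMeasure Ω) :=
    memLp_indicator_const 2 hKm 1 (Or.inr (measure_ne_top _ _))
  have htr : IsTrace Ω 0 (hind.toLp _) := by
    refine ⟨z, squeeze_zero_norm hzn tendsto_one_div_add_atTop_nhds_zero_nat, ?_⟩
    refine tendsto_eLpNorm_two_zero_of_dominated (g := fun _ => (1 : ℝ))
      (fun n => (H1Cont.aestronglyMeasurable_values (z n)).sub (Lp.aestronglyMeasurable _))
      (memLp_const 1) (fun n => ?_) ?_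
    · filter_upwards [hind.coeFn_toLp, ae_mem_frontier Ω] with x hx hxΓ
      have hxc := frontier_subset_closure hxΓ
      have h01 := hz01 n x hxc
      rw [hx, norm_one, Real.norm_eq_abs, abs_le]
      by_cases hxK : x ∈ K
      · rw [hz1 n x hxc hxK, indicator_of_mem hxK]
        norm_num
      · rw [indicator_of_notMem hxK, sub_zero]
        exact ⟨by linarith [h01.1], h01.2⟩
    · filter_upwards [hind.coeFn_toLp, ae_mem_frontier Ω] with x hx hxΓ
      have hxc := frontier_subset_closure hxΓ
      rw [hx]
      refine tendsto_const_nhds.congr' ?_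
      by_cases hxK : x ∈ K
      · refine Eventually.of_forall fun n => ?_
        simp only [hz1 n x hxc hxK, indicator_of_mem hxK, sub_self]
      -- Off the closed set `K` the distance is positive, so `x` eventually leaves the shrinking
      -- neighbourhoods.
      · have hpos : 0 < Metric.infDist x K :=
          (hK.isClosed.notMem_iff_infDist_pos hKne).1 hxK
        filter_upwards [tendsto_one_div_add_atTop_nhds_zero_nat.eventually (gt_mem_nhds hpos)]
          with n hn
        have hn' : x ∉ Metric.thickening (1 / ((n : ℝ) + 1)) K := by
          rw [Metric.mem_thickening_iff_infDist_lt hKne]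
          exact hn.not_gt
        simp only [hz0 n x hxc hn', indicator_of_notMem hxK, sub_zero]
  have h0 := (h _).1 htr
  rw [Lp.eq_zero_iff_ae_eq_zero] at h0
  rw [measure_eq_zero_iff_ae_notMem]
  filter_upwards [h0, hind.coeFn_toLp] with x h1 h2 hxK
  rw [h2, indicator_of_mem hxK] at h1
  exact one_ne_zero h1

/-- Finite Borel measures on `ℝ^d` are inner regular by compact sets; compactness is what permits a
smooth cutoff between `K` and the open set `V`. -/
theorem boundaryMeasure_eq_zero_of_relCap {d : ℕ} {Ω : Set (Euc d)} (hΩ : IsOpen Ω)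
    (hb : Bornology.IsBounded Ω) [IsFiniteMeasure (boundaryMeasure Ω)] (h : TraceUnique Ω)
    {B : Set (Euc d)} (hBm : MeasurableSet B) (hB : relCap Ω B = 0) :
    boundaryMeasure Ω B = 0 := by
  rw [hBm.measure_eq_iSup_isCompact_of_ne_top (measure_ne_top _ _)]
  simp only [ENNReal.iSup_eq_zero]
  exact fun K hKB hK => boundaryMeasure_eq_zero_of_isCompact hΩ hb h hB hKB hK

end RoughTrace

end

theorem proposition4p2 (d : ℕ) (hd : 2 ≤ d) (Ω : Set (RoughTrace.Euc d))
    (hopen : IsOpen Ω) (hconn : IsConnected Ω) (hbdd : Bornology.IsBounded Ω)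
    (hfin : Measure.hausdorffMeasure ((d : ℝ) - 1) (frontier Ω) < ⊤) :
    List.TFAE
      [RoughTrace.TraceUnique Ω,
       RoughTrace.IsClosableForm (RoughTrace.H1Cont.toL2 Ω) (RoughTrace.robinForm Ω),
       ∀ B : Set (RoughTrace.Euc d), B ⊆ frontier Ω → MeasurableSet B →
         RoughTrace.relCap Ω B = 0 → RoughTrace.boundaryMeasure Ω B = 0] := by
  have := RoughTrace.isFiniteMeasure_boundaryMeasure hfin
  tfae_have 1 → 2 := RoughTrace.isClosableForm_of_traceUnique hopen hbdd
  tfae_have 2 → 1 := RoughTrace.traceUnique_of_isClosableForm hbdd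
  tfae_have 1 → 3 := fun h B _ hBm hB =>
    RoughTrace.boundaryMeasure_eq_zero_of_relCap hopen hbdd h hBm hB
  tfae_have 3 → 1 := RoughTrace.traceUnique_of_relCap hopen hbdd
  tfae_finish
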